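/- Let $A\in\mathbb C^{n\times n}$ have all its eigenvalues in the open unit disc, let $B\in\mathbb C^{n\times m}$ have full column rank (so $m\le n$), and let $(A,B)$ be reachable, i.e. $[B,AB,\dots,A^{n-1}B]$ has rank $n$. Put $G(z)=(zI-A)^{-1}B$, let $\mathbb T$ be the unit circle, and let $\mathfrak H_k$ be the real vector space of $k\times k$ Hermitian matrices. Define the real linear map $$\Gamma\colon C(\mathbb T;\mathfrak H_m)\to\mathfrak H_n,\qquad \Gamma(\Phi)=\frac1{2\pi}\int_{-\pi}^{\pi}G(e^{i\theta})\,\Phi(e^{i\theta})\,G(e^{i\theta})^*\,d\theta ,$$ and let $\Pi_{\operatorname{im}\Gamma}$ be the orthogonal projection onto $\operatorname{im}\Gamma$ with respect to the inner product $\langle X,Y\rangle=\operatorname{Re}\operatorname{tr}(X^*Y)$. Let $$\mathscr L_+^\Gamma=\{\Lambda\in\operatorname{im}\Gamma:\ G(z)^*\Lambda G(z)>0\ \text{ for all } z\in\mathbb T\},$$ $$\mathfrak C=\{C\in\mathbb C^{m\times n}:\ CB\text{ is lower triangular with real diagonal entries}\},$$ and let $\mathscr C_+$ be the set of those $C\in\mathbb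 C^{m\times n}$ such that $CB$ is lower triangular with real and positive diagonal entries and all the eigenvalues of $A-B(CB)^{-1}CA$ lie in the open unit disc; thus $\mathscr C_+\subset\mathfrak C$. For $\Lambda\in\mathscr L_+^\Gamma$ the discrete-time algebraic Riccati equation $$\Pi=A^*\Pi A-A^*\Pi B(B^*\Pi B)^{-1}B^*\Pi A+\Lambda$$ has exactly one stabilizing solution $P$, i.e. a Hermitian solution with $B^*PB$ invertible and with all the eigenvalues of $A-B(B^*PB)^{-1}B^*PA$ in the open unit disc. Moreover $B^*PB=L^*L$ with $L$ lower triangular having real and positive diagonal entries, and the matrix $C=L^{-*}B^*P$ is uniquely determined by $\Lambda$. Write $h(\Lambda):=C$. **Theorem.** The real vector spaces $\mathfrak C$ and $\operatorname{im}\Gamma$ both have dimension $m(2n-m)$. The sets $\mathscr L_+^\Gamma$ and $\mathscr C_+$ are open in $\operatorname{im}\Gamma$ and in $\mathfrak C$, respectively. The map $h$ is a bijection of $\mathscr L_+^\Gamma$ onto $\mathscr C_+$ whose inverse is $$h^{-1}\colon\mathscr C_+\to\mathscr L_+^\Gamma,\qquad C\mapsto\Pi_{\operatorname{im}\Gamma}(C^*C).$$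 The Jacobian determinant of $h^{-1}$, with respect to any bases of $\mathfrak C$ and $\operatorname{im}\Gamma$, vanishes nowhere on $\mathscr C_+$, and $h\colon\mathscr L_+^\Gamma\to\mathscr C_+$ is a $C^1$ diffeomorphism. For every $\Lambda\in\mathscr L_+^\Gamma$, the matrix $C=h(\Lambda)$ satisfies $G(z)^*\Lambda G(z)=G(z)^*C^*CG(z)$ for all $z\in\mathbb T$. -/

import Mathlib

open scoped Matrix ComplexOrder

noncomputable section

namespace SpectralFactorization

/-- Matrices carry the Frobenius norm. -/
instance frobeniusNorm {k l : ℕ} : NormedAddCommGroup (Matrix (Fin k) (Fin l) ℂ) :=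
  Matrix.frobeniusNormedAddCommGroup

/-- The real inner product `⟪X, Y⟫ = Re tr (X* Y)` on complex matrices; it induces the Frobenius
norm. On Hermitian matrices it is `tr (X Y)`. -/
instance frobeniusInner {k l : ℕ} : InnerProductSpace ℝ (Matrix (Fin k) (Fin l) ℂ) where
  toNormedSpace := Matrix.frobeniusNormedSpace
  inner X Y := (Xᴴ * Y).trace.re
  norm_sq_eq_re_inner X := by
    have h0 : 0 ≤ ∑ i, ∑ j, ‖X i j‖ ^ (2 : ℝ) :=
      Finset.sum_nonneg fun i _ => Finset.sum_nonneg fun j _ => by positivity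
    rw [Matrix.frobenius_norm_def, ← Real.sqrt_eq_rpow, Real.sq_sqrt h0, Finset.sum_comm]
    simp only [RCLike.re_to_real, Matrix.trace, Matrix.diag, Matrix.mul_apply,
      Matrix.conjTranspose_apply, Complex.re_sum]
    refine Finset.sum_congr rfl fun i _ => Finset.sum_congr rfl fun j _ => ?_
    rw [Real.rpow_two, ← Complex.normSq_eq_norm_sq, Complex.normSq_apply]
    simp
  conj_inner_symm X Y := by
    have h : (Xᴴ * Y).trace = star (Yᴴ * X).trace := by
      rw [← Matrix.trace_conjTranspose, Matrix.conjTranspose_mul, Matrix.conjTranspose_conjTranspose]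
    simp [h]
  add_left X Y Z := by
    simp [Matrix.add_mul]
  smul_left X Y r := by
    simp [Matrix.conjTranspose_smul, Matrix.smul_mul, Matrix.trace_smul]

/-- Linear subspaces of matrix spaces carry the uniform structure and the topology of the Frobenius
norm. They are by definition the same as the entrywise ones; these two instances only select the
form that comes from the norm. -/
instance {k l : ℕ} (p : Submodule ℝ (Matrix (Fin k) (Fin l) ℂ)) : UniformSpace p :=
  PseudoMetricSpace.toUniformSpace

instance {k l : ℕ} (p : Submodule ℝ (Matrix (Fin k) (Fin l) ℂ)) : TopologicalSpace p :=
  PseudoMetricSpace.toUniformSpace.toTopologicalSpace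

/-- The real vector space of `k × k` Hermitian matrices. -/
abbrev Herm (k : ℕ) : Submodule ℝ (Matrix (Fin k) (Fin k) ℂ) :=
  selfAdjoint.submodule ℝ (Matrix (Fin k) (Fin k) ℂ)

/-- All eigenvalues lie strictly inside the unit circle. -/
def IsSchurStable {k : ℕ} (A : Matrix (Fin k) (Fin k) ℂ) : Prop :=
  ∀ μ ∈ spectrum ℂ A, ‖μ‖ < 1

/-- The reachability matrix `[B, A B, …, A ^ (n - 1) B]`. -/
def reachabilityMatrix {n m : ℕ} (A : Matrix (Fin n) (Fin n) ℂ) (B : Matrix (Fin n) (Fin m) ℂ) :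
    Matrix (Fin n) (Fin n × Fin m) ℂ :=
  Matrix.of fun i p => (A ^ (p.1 : ℕ) * B) i p.2

/-- Lower triangular with real and positive diagonal entries. -/
def IsLowerPos {k : ℕ} (L : Matrix (Fin k) (Fin k) ℂ) : Prop :=
  (∀ i j, i < j → L i j = 0) ∧ ∀ i, (L i i).im = 0 ∧ 0 < (L i i).re

/-- The data of the filter bank `G(z) = (z I - A)⁻¹ B`: `A` is Schur stable, `B` has full column
rank (so that `m ≤ n`), and the pair `(A, B)` is reachable. -/
structure FilterBank (n m : ℕ) where
  A : Matrix (Fin n) (Fin n) ℂ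
  B : Matrix (Fin n) (Fin m) ℂ
  stable : IsSchurStable A
  fullRank : B.rank = m
  reachable : (reachabilityMatrix A B).rank = n

namespace FilterBank

variable {n m : ℕ} (S : FilterBank n m)

/-- The transfer function `G(z) = (z I - A)⁻¹ B`. -/
def G (z : ℂ) : Matrix (Fin n) (Fin m) ℂ := (z • (1 : Matrix (Fin n) (Fin n) ℂ) - S.A)⁻¹ * S.B

theorem continuous_G : Continuous fun z : Circle => S.G (z : ℂ) := by
  have hu (z : Circle) : IsUnit ((z : ℂ) • (1 : Matrix (Fin n) (Fin n) ℂ) - S.A) := by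
    by_contra h
    have hz : (z : ℂ) ∈ spectrum ℂ S.A := by
      rw [spectrum.mem_iff, Algebra.algebraMap_eq_smul_one]
      exact h
    have := S.stable _ hz
    exact absurd this (by rw [Circle.norm_coe]; exact lt_irrefl 1)
  unfold G
  refine Continuous.matrix_mul ?_ continuous_const
  have hc : Continuous fun z : Circle => (z : ℂ) • (1 : Matrix (Fin n) (Fin n) ℂ) - S.A := by
    fun_prop
  have hd : Continuous fun z : Circle =>
      ((z : ℂ) • (1 : Matrix (Fin n) (Fin n) ℂ) - S.A).det⁻¹ :=
    hc.matrix_det.inv₀ fun z => ((Matrix.isUnit_iff_isUnit_det _).1 (hu z)).ne_zero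
  simp only [Matrix.inv_def, Ring.inverse_eq_inv']
  exact hd.smul hc.matrix_adjugate

/-- The Hermitian matrix `G(z) X G(z)*`. -/
def integrand (z : Circle) (X : Herm m) : Herm n :=
  ⟨S.G z * (X : Matrix (Fin m) (Fin m) ℂ) * (S.G z)ᴴ,
    Matrix.isHermitian_mul_mul_conjTranspose (S.G z) X.2⟩

theorem continuous_integrand (Φ : C(Circle, Herm m)) :
    Continuous fun θ : ℝ => S.integrand (Circle.exp θ) (Φ (Circle.exp θ)) := by
  have hG : Continuous fun θ : ℝ => S.G (Circle.exp θ : ℂ) :=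
    S.continuous_G.comp Circle.exp.continuous
  have hΦ : Continuous fun θ : ℝ => (Φ (Circle.exp θ) : Matrix (Fin m) (Fin m) ℂ) :=
    continuous_subtype_val.comp (Φ.continuous.comp Circle.exp.continuous)
  exact Continuous.subtype_mk ((hG.matrix_mul hΦ).matrix_mul hG.matrix_conjTranspose) _

/-- The operator `Γ : Φ ↦ ∫ G Φ G*`, the integral being over the unit circle with respect to the
normalized Lebesgue measure. -/
def Γ : C(Circle, Herm m) →ₗ[ℝ] Herm n where
  toFun Φ := (2 * Real.pi)⁻¹ •
    ∫ θ in (-Real.pi)..Real.pi, S.integrand (Circle.exp θ) (Φ (Circle.exp θ))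
  map_add' Φ Ψ := by
    rw [← smul_add, ← intervalIntegral.integral_add
      ((S.continuous_integrand Φ).intervalIntegrable _ _)
      ((S.continuous_integrand Ψ).intervalIntegrable _ _)]
    congr 2
    funext θ
    apply Subtype.ext
    simp [integrand, Matrix.mul_add, Matrix.add_mul]
  map_smul' c Φ := by
    rw [RingHom.id_apply, smul_comm c, ← intervalIntegral.integral_smul c]
    congr 2
    funext θ
    apply Subtype.ext
    simp [integrand]

/-- The range of `Γ`, as a real linear space of (Hermitian) matrices. -/
def imΓ : Submodule ℝ (Matrix (Fin n) (Fin n) ℂ) := (LinearMap.range S.Γ).map (Herm n).subtype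

/-- The set `𝓛₊` of Hermitian `Λ` with `G(z)* Λ G(z) > 0` on the unit circle. -/
def LPlus : Set (Matrix (Fin n) (Fin n) ℂ) :=
  {Λ | Λ.IsHermitian ∧ ∀ z : Circle, ((S.G z)ᴴ * Λ * S.G z).PosDef}

/-- The set `𝓛₊ ∩ im Γ`, as a subset of the space `im Γ`. -/
def LPlusΓ : Set S.imΓ := {Λ | (Λ : Matrix (Fin n) (Fin n) ℂ) ∈ S.LPlus}

/-- The real linear space of the `m × n` matrices `C` such that `C B` is lower triangular with
real diagonal entries. -/
def 𝔠 : Submodule ℝ (Matrix (Fin m) (Fin n) ℂ) where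
  carrier := {C | (∀ i j, i < j → (C * S.B) i j = 0) ∧ ∀ i, ((C * S.B) i i).im = 0}
  add_mem' {C D} hC hD := by
    refine ⟨fun i j hij => ?_, fun i => ?_⟩
    · simp [Matrix.add_mul, hC.1 i j hij, hD.1 i j hij]
    · simp [Matrix.add_mul, hC.2 i, hD.2 i]
  zero_mem' := by simp
  smul_mem' r C hC := by
    refine ⟨fun i j hij => ?_, fun i => ?_⟩
    · simp [hC.1 i j hij]
    · simp [hC.2 i]

/-- The set `𝓒₊` of the matrices `C` such that `C B` is lower triangular with real and positive
diagonal entries and `A - B (C B)⁻¹ C A` is Schur stable, as a subset of the space `𝔠`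
(which contains all such `C`). -/
def CPlus : Set S.𝔠 :=
  {C | IsLowerPos ((C : Matrix (Fin m) (Fin n) ℂ) * S.B) ∧
    IsSchurStable (S.A - S.B * ((C : Matrix (Fin m) (Fin n) ℂ) * S.B)⁻¹ * (C : Matrix (Fin m) (Fin n) ℂ) * S.A)}

/-- `P` is a stabilizing (Hermitian) solution of the discrete-time algebraic Riccati equation
`Π = A* Π A - A* Π B (B* Π B)⁻¹ B* Π A + Λ`. -/
structure IsStabilizingSolution (Λ P : Matrix (Fin n) (Fin n) ℂ) : Prop where
  isHermitian : P.IsHermitian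
  isUnit : IsUnit (S.Bᴴ * P * S.B)
  riccati : P = S.Aᴴ * P * S.A
    - S.Aᴴ * P * S.B * (S.Bᴴ * P * S.B)⁻¹ * S.Bᴴ * P * S.A + Λ
  stable : IsSchurStable (S.A - S.B * (S.Bᴴ * P * S.B)⁻¹ * S.Bᴴ * P * S.A)

/-- `C = L⁻* B* P`, where `P` is a stabilizing solution of the Riccati equation with parameter `Λ`
and `L` is the right Cholesky factor of `B* P B`, i.e. `B* P B = L* L` with `L` lower triangular
having real and positive diagonal entries. -/
def IsSpectralFactor (Λ : Matrix (Fin n) (Fin n) ℂ) (C : Matrix (Fin m) (Fin n) ℂ) : Prop :=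
  ∃ (P : Matrix (Fin n) (Fin n) ℂ) (L : Matrix (Fin m) (Fin m) ℂ),
    S.IsStabilizingSolution Λ P ∧ S.Bᴴ * P * S.B = Lᴴ * L ∧ IsLowerPos L ∧
      C = (Lᴴ)⁻¹ * S.Bᴴ * P

/-- The map `C ↦ Π_{im Γ} (C* C)`, where `Π_{im Γ}` is the orthogonal projection onto `im Γ`. -/
def hInv (C : S.𝔠) : S.imΓ :=
  S.imΓ.orthogonalProjectionOnto
    ((C : Matrix (Fin m) (Fin n) ℂ)ᴴ * (C : Matrix (Fin m) (Fin n) ℂ))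

end FilterBank

end SpectralFactorization

end

/-! The map `C ↦ Π(C*C)` is quadratic and explicit, so everything is proved for it, and `h` is
obtained as its inverse. No prior existence theorem for the Riccati equation is needed.

The key is a description of `(im Γ)ᗮ`. For Hermitian `Y`, testing `Γ` against `Φ = G*YG` gives `Y ∈
(im Γ)ᗮ` iff `G*YG = 0` on the circle (`mem_orthogonal_imΓ_iff`). This happens iff `Y = X - A*XA`
with `X` Hermitian and `B*X = 0` (`exists_of_G_congr_eq_zero`, `G_congr_eq_zero`). So `Π(C*C) = Λ`
says both that `G*ΛG = G*C*CG` and that `C*C - Λ = X - A*XA` for such an `X`. In the second form `P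
= C*C - X` is the stabilizing Riccati solution, and conversely (`isSpectralFactor_iff`). Uniqueness
of `P` and of the Cholesky factor then gives injectivity on `𝓒₊`.

The derivative at `C` is `V ↦ Π(C*V + V*C)`. With `F = A - B(CB)⁻¹CA` one has `CF = 0`, and `F*XF =
A*XA` whenever `X` is Hermitian and `B*X = 0`. Inverting the derivative thereby reduces to a Stein
equation for the stable matrix `F`, and the triangular normalization removes the remaining unitary
freedom. Hence the derivative is bijective on `𝓒₊`. At a single point of `𝓒₊` this already gives the
dimension of `im Γ`.

Surjectivity is a continuity argument. The image of `𝓒₊` is open by the inverse function theorem and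
relatively closed in `𝓛₊ ∩ im Γ` by a compactness argument (`mem_image_of_mem_closure`). The set `𝓛₊
∩ im Γ` is convex, hence connected, so the image is all of it. -/

noncomputable section

open Filter Topology

namespace SpectralFactorization

/-! ### Schur stable matrices and Stein equations -/

section Stable

variable {k : ℕ}

/-- The powers of a Schur stable matrix tend to zero. -/
theorem IsSchurStable.tendsto_pow {M : Matrix (Fin k) (Fin k) ℂ} (hM : IsSchurStable M) :
    Tendsto (fun j : ℕ => M ^ j) atTop (𝓝 0) := by
  rcases subsingleton_or_nontrivial (Matrix (Fin k) (Fin k) ℂ) with h | h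
  · exact tendsto_const_nhds.congr fun j => Subsingleton.elim _ _
  let : NormedRing (Matrix (Fin k) (Fin k) ℂ) := Matrix.frobeniusNormedRing
  let : NormedAlgebra ℂ (Matrix (Fin k) (Fin k) ℂ) := Matrix.frobeniusNormedAlgebra
  have : CompleteSpace (Matrix (Fin k) (Fin k) ℂ) := FiniteDimensional.complete ℂ _
  have hr : spectralRadius ℂ M < 1 := by
    have := spectrum.spectralRadius_lt_of_forall_lt M (r := 1) fun z hz => by
      simpa [← NNReal.coe_lt_coe] using hM z hz
    simpa using this
  obtain ⟨r, hr1, hr2⟩ := ENNReal.lt_iff_exists_nnreal_btwn.1 hr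
  have hr2' : r < 1 := by exact_mod_cast hr2
  have hev := (spectrum.pow_nnnorm_pow_one_div_tendsto_nhds_spectralRadius M).eventually
    (gt_mem_nhds hr1)
  refine squeeze_zero_norm' (a := fun j => (r : ℝ) ^ j) ?_
    (tendsto_pow_atTop_nhds_zero_of_lt_one r.2 hr2')
  filter_upwards [hev, eventually_gt_atTop 0] with j hj hj0
  have h1 : (‖M ^ j‖₊ : ENNReal) < (r : ENNReal) ^ j := by
    have := ENNReal.rpow_lt_rpow hj (z := (j : ℝ)) (by exact_mod_cast hj0)
    rwa [← ENNReal.rpow_mul, one_div, inv_mul_cancel₀ (by exact_mod_cast hj0.ne'),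
      ENNReal.rpow_one, ENNReal.rpow_natCast] at this
  have h2 : ‖M ^ j‖₊ < r ^ j := by exact_mod_cast h1
  exact_mod_cast h2.le

/-- The Stein equation `X = N* X M` has only the trivial solution. -/
theorem IsSchurStable.eq_zero_of_stein {M N : Matrix (Fin k) (Fin k) ℂ} (hM : IsSchurStable M)
    (hN : IsSchurStable N) {X : Matrix (Fin k) (Fin k) ℂ} (h : X = Nᴴ * X * M) : X = 0 := by
  have hp (j : ℕ) : X = (N ^ j)ᴴ * X * M ^ j := by
    induction j with
    | zero => simp
    | succ j ih =>
      rw [pow_succ', pow_succ, Matrix.conjTranspose_mul]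
      calc X = Nᴴ * X * M := h
        _ = Nᴴ * ((N ^ j)ᴴ * X * M ^ j) * M := by rw [← ih]
        _ = (Nᴴ * (N ^ j)ᴴ) * X * (M ^ j * M) := by simp only [Matrix.mul_assoc]
        _ = _ := by
          rw [← Matrix.conjTranspose_mul, ← Matrix.conjTranspose_mul, ← pow_succ, ← pow_succ']
  have ht : Tendsto (fun j : ℕ => (N ^ j)ᴴ * X * M ^ j) atTop (𝓝 ((0 : Matrix _ _ ℂ)ᴴ * X * 0)) :=
    Tendsto.mul (Tendsto.mul ((Continuous.matrix_conjTranspose continuous_id).tendsto _ |>.comp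
      hN.tendsto_pow) tendsto_const_nhds) hM.tendsto_pow
  rw [Matrix.mul_zero] at ht
  exact tendsto_nhds_unique (tendsto_const_nhds.congr hp) ht

/-- The Stein equation `X - M* X M = Y` is solvable when `M` is Schur stable. -/
theorem IsSchurStable.exists_stein {M : Matrix (Fin k) (Fin k) ℂ} (hM : IsSchurStable M)
    {Y : Matrix (Fin k) (Fin k) ℂ} (hY : Y.IsHermitian) :
    ∃ X : Matrix (Fin k) (Fin k) ℂ, X.IsHermitian ∧ X - Mᴴ * X * M = Y := by
  let T : Matrix (Fin k) (Fin k) ℂ →ₗ[ℂ] Matrix (Fin k) (Fin k) ℂ :=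
    { toFun := fun X => X - Mᴴ * X * M
      map_add' := fun X Y => by simp only [Matrix.mul_add, Matrix.add_mul]; abel
      map_smul' := fun c X => by simp [smul_sub] }
  have hT (X : Matrix (Fin k) (Fin k) ℂ) : T X = X - Mᴴ * X * M := rfl
  have hinj : Function.Injective T := by
    rw [← LinearMap.ker_eq_bot, LinearMap.ker_eq_bot']
    intro X hX
    exact hM.eq_zero_of_stein hM (sub_eq_zero.1 hX)
  obtain ⟨X, hX⟩ := LinearMap.surjective_of_injective hinj Y
  refine ⟨X, hinj ?_, hX⟩
  rw [hX, hT, ← hY.eq, ← hX, hT]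
  simp [Matrix.mul_assoc]

theorem IsSchurStable.det_ne_zero {M : Matrix (Fin k) (Fin k) ℂ} (hM : IsSchurStable M) {w : ℂ}
    (hw : ‖w‖ ≤ 1) : (1 - w • M).det ≠ 0 := by
  intro h
  obtain ⟨v, hv, hv0⟩ := Matrix.exists_mulVec_eq_zero_iff.2 h
  rw [Matrix.sub_mulVec, Matrix.one_mulVec, Matrix.smul_mulVec, sub_eq_zero] at hv0
  have hw0 : w ≠ 0 := by
    rintro rfl
    exact hv (by simpa using hv0)
  have h1 : w⁻¹ ∈ spectrum ℂ M := by
    rw [spectrum.mem_iff, Algebra.algebraMap_eq_smul_one, Matrix.isUnit_iff_isUnit_det,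
      isUnit_iff_ne_zero, not_not, ← Matrix.exists_mulVec_eq_zero_iff]
    refine ⟨v, hv, ?_⟩
    rw [Matrix.sub_mulVec, Matrix.smul_mulVec, Matrix.one_mulVec, sub_eq_zero]
    nth_rewrite 1 [hv0]
    rw [smul_smul, inv_mul_cancel₀ hw0, one_smul]
  have h2 := hM _ h1
  rw [norm_inv] at h2
  exact absurd h2 (not_lt.2 ((one_le_inv₀ (norm_pos_iff.2 hw0)).2 hw))

/-- Eigenvalues `μ` outside the open disc correspond to zeros `w = μ⁻¹` of `det(1 - wM)` in the
closed disc. This form suits holomorphic functions of `w` on a compact disc. -/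
theorem isSchurStable_iff_det_ne_zero {M : Matrix (Fin k) (Fin k) ℂ} :
    IsSchurStable M ↔ ∀ w : ℂ, ‖w‖ ≤ 1 → (1 - w • M).det ≠ 0 := by
  refine ⟨fun hM w hw => hM.det_ne_zero hw, fun h μ hμ => ?_⟩
  by_contra! hμ1
  have hμ0 : μ ≠ 0 := by
    rintro rfl
    simp at hμ1
    linarith
  rw [spectrum.mem_iff, Algebra.algebraMap_eq_smul_one, Matrix.isUnit_iff_isUnit_det,
    isUnit_iff_ne_zero, not_not] at hμ
  refine h μ⁻¹ (by rw [norm_inv]; exact inv_le_one_of_one_le₀ hμ1) ?_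
  have : (1 : Matrix (Fin k) (Fin k) ℂ) - μ⁻¹ • M = μ⁻¹ • (μ • 1 - M) := by
    rw [smul_sub, smul_smul, inv_mul_cancel₀ hμ0, one_smul]
  rw [this, Matrix.det_smul, hμ, mul_zero]

end Stable

/-! ### Triangular matrices and Cholesky uniqueness -/

section Triangular

variable {k : ℕ}

/-- Lower triangular with real diagonal entries. -/
def IsLowerReal (L : Matrix (Fin k) (Fin k) ℂ) : Prop :=
  (∀ i j, i < j → L i j = 0) ∧ ∀ i, (L i i).im = 0

theorem IsLowerPos.isLowerReal {L : Matrix (Fin k) (Fin k) ℂ} (h : IsLowerPos L) :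
    IsLowerReal L := ⟨h.1, fun i => (h.2 i).1⟩

theorem det_of_lower {L : Matrix (Fin k) (Fin k) ℂ} (h : ∀ i j, i < j → L i j = 0) :
    L.det = ∏ i, L i i :=
  Matrix.det_of_isLowerTriangular L fun i j hij => h i j hij

theorem IsLowerPos.isUnit {L : Matrix (Fin k) (Fin k) ℂ} (h : IsLowerPos L) : IsUnit L := by
  rw [Matrix.isUnit_iff_isUnit_det, isUnit_iff_ne_zero, det_of_lower h.1, Finset.prod_ne_zero_iff]
  intro i _ hi
  have := (h.2 i).2
  simp [hi] at this

theorem mul_diag_of_lower {L M : Matrix (Fin k) (Fin k) ℂ} (hL : ∀ i j, i < j → L i j = 0)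
    (hM : ∀ i j, i < j → M i j = 0) (i : Fin k) : (L * M) i i = L i i * M i i := by
  rw [Matrix.mul_apply]
  refine Finset.sum_eq_single i (fun j _ hj => ?_) (by simp)
  rcases lt_or_gt_of_ne hj with h | h
  · rw [hM j i h, mul_zero]
  · rw [hL i j h, zero_mul]

theorem mul_lower {L M : Matrix (Fin k) (Fin k) ℂ} (hL : ∀ i j, i < j → L i j = 0)
    (hM : ∀ i j, i < j → M i j = 0) (i j : Fin k) (hij : i < j) : (L * M) i j = 0 := by
  rw [Matrix.mul_apply]
  refine Finset.sum_eq_zero fun l _ => ?_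
  rcases lt_or_ge i l with h | h
  · rw [hL i l h, zero_mul]
  · rw [hM l j (h.trans_lt hij), mul_zero]

theorem IsLowerReal.mul {L M : Matrix (Fin k) (Fin k) ℂ} (hL : IsLowerReal L)
    (hM : IsLowerReal M) : IsLowerReal (L * M) := by
  refine ⟨mul_lower hL.1 hM.1, fun i => ?_⟩
  rw [mul_diag_of_lower hL.1 hM.1]
  simp [hL.2 i, hM.2 i]

theorem IsLowerPos.inv {L : Matrix (Fin k) (Fin k) ℂ} (hL : IsLowerPos L) : IsLowerPos L⁻¹ := by
  have hu := hL.isUnit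
  have hlow : ∀ i j, i < j → L⁻¹ i j = 0 := by
    let := hu.invertible
    have h1 : L.BlockTriangular OrderDual.toDual := fun i j hij => hL.1 i j hij
    exact fun i j hij => Matrix.blockTriangular_inv_of_blockTriangular h1 hij
  refine ⟨hlow, fun i => ?_⟩
  have h1 : L i i * L⁻¹ i i = 1 := by
    rw [← mul_diag_of_lower hL.1 hlow, Matrix.mul_nonsing_inv _
      ((Matrix.isUnit_iff_isUnit_det _).1 hu), Matrix.one_apply_eq]
  have h2 : L i i = ((L i i).re : ℂ) := by
    apply Complex.ext <;> simp [(hL.2 i).1]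
  have h3 : L⁻¹ i i = (((L i i).re)⁻¹ : ℝ) := by
    rw [eq_inv_of_mul_eq_one_right h1, h2]
    push_cast
    simp
  rw [h3]
  exact ⟨Complex.ofReal_im _, by simpa using (hL.2 i).2⟩

theorem IsLowerPos.mul {L M : Matrix (Fin k) (Fin k) ℂ} (hL : IsLowerPos L)
    (hM : IsLowerPos M) : IsLowerPos (L * M) := by
  refine ⟨mul_lower hL.1 hM.1, fun i => ?_⟩
  rw [mul_diag_of_lower hL.1 hM.1]
  simpa [(hL.2 i).1, (hM.2 i).1] using mul_pos (hL.2 i).2 (hM.2 i).2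

/-- A lower triangular skew-Hermitian matrix with real diagonal vanishes. -/
theorem IsLowerReal.eq_zero {L : Matrix (Fin k) (Fin k) ℂ} (hL : IsLowerReal L)
    (h : L + Lᴴ = 0) : L = 0 := by
  have h' (i j : Fin k) : L i j = -star (L j i) := by
    have := congrFun (congrFun h i) j
    rw [Matrix.add_apply, Matrix.conjTranspose_apply, Matrix.zero_apply] at this
    exact eq_neg_of_add_eq_zero_left this
  ext i j
  rcases lt_trichotomy i j with hij | rfl | hij
  · exact hL.1 i j hij
  · have := congrArg Complex.re (h' i i)
    apply Complex.ext
    · simp at this ⊢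
      linarith
    · simpa using hL.2 i
  · rw [h' i j, hL.1 j i hij]
    simp

/-- Every Hermitian matrix is `N + N*` with `N` lower triangular with real diagonal. -/
theorem exists_isLowerReal_add {M : Matrix (Fin k) (Fin k) ℂ} (hM : M.IsHermitian) :
    ∃ N, IsLowerReal N ∧ N + Nᴴ = M := by
  refine ⟨Matrix.of fun i j => if j < i then M i j else if i = j then M i j / 2 else 0,
    ⟨fun i j hij => ?_, fun i => ?_⟩, ?_⟩
  · simp [hij.not_gt, hij.ne]
  · have := congrArg Complex.im (hM.apply i i)
    simp at this ⊢
    linarith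
  · ext i j
    have h := hM.apply i j
    rcases lt_trichotomy i j with hij | rfl | hij
    · simpa [hij.not_gt, hij.ne, hij, hij.ne'] using h
    · have h2 : (starRingEnd ℂ) (M i i) = M i i := h
      simp [h2]
    · simp [hij.not_gt, hij.ne, hij]

/-- The Cholesky factor is unique. -/
theorem IsLowerPos.eq_of_mul_eq {L M : Matrix (Fin k) (Fin k) ℂ} (hL : IsLowerPos L)
    (hM : IsLowerPos M) (h : Lᴴ * L = Mᴴ * M) : L = M := by
  have hMu := (Matrix.isUnit_iff_isUnit_det _).1 hM.isUnit
  set N := L * M⁻¹ with hN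
  have hNp : IsLowerPos N := hL.mul hM.inv
  have hNN : Nᴴ * N = 1 := by
    rw [hN, Matrix.conjTranspose_mul]
    calc M⁻¹ᴴ * Lᴴ * (L * M⁻¹) = M⁻¹ᴴ * (Lᴴ * L) * M⁻¹ := by simp only [Matrix.mul_assoc]
      _ = (M * M⁻¹)ᴴ * (M * M⁻¹) := by
        rw [h, Matrix.conjTranspose_mul]; simp only [Matrix.mul_assoc]
      _ = 1 := by rw [Matrix.mul_nonsing_inv _ hMu]; simp
  -- The inverse of `N` is lower triangular and equals `N*`, so `N` is diagonal; unitarity and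
  -- positivity make it the identity.
  have hinv : N⁻¹ = Nᴴ := Matrix.inv_eq_left_inv hNN
  have hup : ∀ i j, i < j → Nᴴ i j = 0 := hinv ▸ hNp.inv.1
  have hdiag (i : Fin k) : N i i = 1 := by
    have h1 : star (N i i) * N i i = 1 := by
      have := mul_diag_of_lower hup hNp.1 i
      rw [hNN, Matrix.one_apply_eq] at this
      exact this.symm
    have h2 : N i i = ((N i i).re : ℂ) := by apply Complex.ext <;> simp [(hNp.2 i).1]
    rw [h2] at h1 ⊢
    have h3 : (N i i).re * (N i i).re = 1 := by
      have := congrArg Complex.re h1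
      simpa using this
    have h4 : (N i i).re = 1 := by nlinarith [(hNp.2 i).2]
    rw [h4, Complex.ofReal_one]
  have hN1 : N = 1 := by
    ext i j
    rcases lt_trichotomy i j with hij | rfl | hij
    · rw [hNp.1 i j hij, Matrix.one_apply_ne hij.ne]
    · rw [hdiag, Matrix.one_apply_eq]
    · have := hup j i hij
      rw [Matrix.conjTranspose_apply, star_eq_zero] at this
      rw [this, Matrix.one_apply_ne hij.ne']
  calc L = N * M := by rw [hN, Matrix.mul_assoc, Matrix.nonsing_inv_mul _ hMu, Matrix.mul_one]
    _ = M := by rw [hN1, Matrix.one_mul]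

end Triangular

/-! ### Holomorphic matrix functions and the maximum principle -/

theorem differentiableAt_det {k : ℕ} {F : ℂ → Matrix (Fin k) (Fin k) ℂ} {w : ℂ}
    (h : ∀ i j, DifferentiableAt ℂ (fun w => F w i j) w) :
    DifferentiableAt ℂ (fun w => (F w).det) w := by
  simp only [Matrix.det_apply]
  refine DifferentiableAt.fun_sum fun σ _ => DifferentiableAt.const_smul ?_ _
  exact DifferentiableAt.fun_finsetProd fun i _ => h _ _

theorem differentiableAt_mul {k l p : ℕ} {F : ℂ → Matrix (Fin k) (Fin l) ℂ}
    {F' : ℂ → Matrix (Fin l) (Fin p) ℂ} {w : ℂ}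
    (h : ∀ i j, DifferentiableAt ℂ (fun w => F w i j) w)
    (h' : ∀ i j, DifferentiableAt ℂ (fun w => F' w i j) w) (i : Fin k) (j : Fin p) :
    DifferentiableAt ℂ (fun w => (F w * F' w) i j) w := by
  simp only [Matrix.mul_apply]
  exact DifferentiableAt.fun_sum fun q _ => (h _ _).mul (h' _ _)

theorem differentiableAt_inv {k : ℕ} {F : ℂ → Matrix (Fin k) (Fin k) ℂ} {w : ℂ}
    (h : ∀ i j, DifferentiableAt ℂ (fun w => F w i j) w) (h0 : (F w).det ≠ 0) (i j : Fin k) :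
    DifferentiableAt ℂ (fun w => (F w)⁻¹ i j) w := by
  simp only [Matrix.inv_def, Ring.inverse_eq_inv', Matrix.smul_apply, smul_eq_mul,
    Matrix.adjugate_apply]
  refine ((differentiableAt_det h).inv h0).mul (differentiableAt_det fun p q => ?_)
  simp only [Matrix.updateRow_apply]
  split_ifs
  · exact differentiableAt_const _
  · exact h _ _

theorem diffContOnCl_unitBall {f : ℂ → ℂ} (h : ∀ w, ‖w‖ ≤ 1 → DifferentiableAt ℂ f w) :
    DiffContOnCl ℂ f (Metric.ball 0 1) := by
  refine DifferentiableOn.diffContOnCl fun w hw => (h w ?_).differentiableWithinAt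
  rw [closure_ball _ one_ne_zero] at hw
  simpa using hw

/-- On the closed unit disc, a holomorphic function is bounded by its bound on the circle. -/
theorem norm_le_of_norm_le_on_circle {f : ℂ → ℂ} (h : ∀ w, ‖w‖ ≤ 1 → DifferentiableAt ℂ f w)
    {c : ℝ} (hc : ∀ w, ‖w‖ = 1 → ‖f w‖ ≤ c) {w : ℂ} (hw : ‖w‖ ≤ 1) : ‖f w‖ ≤ c := by
  refine Complex.norm_le_of_forall_mem_frontier_norm_le Metric.isBounded_ball
    (diffContOnCl_unitBall h) (fun z hz => hc z ?_) (z := w) ?_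
  · rw [frontier_ball _ one_ne_zero] at hz
    simpa using hz
  · rw [closure_ball _ one_ne_zero]
    simpa using hw

theorem eq_zero_of_conjTranspose_mul_trace {k l : ℕ} {E : Matrix (Fin k) (Fin l) ℂ}
    (h : (Eᴴ * E).trace.re ≤ 0) : E = 0 := by
  have h1 : ‖E‖ ^ 2 = (Eᴴ * E).trace.re := (real_inner_self_eq_norm_sq E).symm
  have h2 : ‖E‖ ^ 2 ≤ 0 := h1 ▸ h
  have h3 : ‖E‖ = 0 := by nlinarith [norm_nonneg E]
  exact norm_eq_zero.1 h3

theorem conjTranspose_mul_trace_nonneg {k l : ℕ} (E : Matrix (Fin k) (Fin l) ℂ) :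
    0 ≤ (Eᴴ * E).trace.re := by
  have h1 : ‖E‖ ^ 2 = (Eᴴ * E).trace.re := (real_inner_self_eq_norm_sq E).symm
  rw [← h1]
  positivity

theorem exists_circle_inv_eq {w : ℂ} (hw : ‖w‖ = 1) : ∃ z : Circle, (z : ℂ)⁻¹ = w :=
  ⟨⟨w⁻¹, by simp [Submonoid.unitSphere, hw]⟩, inv_inv w⟩

/-! ### The transfer function and the kernel of `Y ↦ G*YG` -/

namespace FilterBank

variable {n m : ℕ} (S : FilterBank n m)

/-- The function `z G(z) = (I - z⁻¹ A)⁻¹ B` in the variable `w = z⁻¹`. -/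
def K (w : ℂ) : Matrix (Fin n) (Fin m) ℂ := (1 - w • S.A)⁻¹ * S.B

theorem K_zero : S.K 0 = S.B := by simp [K]

theorem K_eq {w : ℂ} (hw : ‖w‖ ≤ 1) : S.K w = S.B + w • (S.A * S.K w) := by
  have h : (1 - w • S.A) * S.K w = S.B := by
    rw [K, ← Matrix.mul_assoc, Matrix.mul_nonsing_inv _
      (isUnit_iff_ne_zero.2 (S.stable.det_ne_zero hw)), Matrix.one_mul]
  rw [Matrix.sub_mul, Matrix.one_mul, Matrix.smul_mul, sub_eq_iff_eq_add] at h
  exact h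

theorem G_eq (z : Circle) : S.G z = (z : ℂ)⁻¹ • S.K (z : ℂ)⁻¹ := by
  have hz : (z : ℂ) ≠ 0 := Circle.coe_ne_zero z
  have h : (z : ℂ) • (1 : Matrix (Fin n) (Fin n) ℂ) - S.A
      = (z : ℂ) • (1 - (z : ℂ)⁻¹ • S.A) := by
    rw [smul_sub, smul_smul, mul_inv_cancel₀ hz, one_smul]
  have hu : IsUnit (1 - (z : ℂ)⁻¹ • S.A).det :=
    isUnit_iff_ne_zero.2 (S.stable.det_ne_zero (by simp [Circle.norm_coe]))
  rw [G, h, K, ← Matrix.smul_mul]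
  congr 1
  refine Matrix.inv_eq_left_inv ?_
  rw [Matrix.smul_mul, Matrix.mul_smul, smul_smul, inv_mul_cancel₀ hz, one_smul,
    Matrix.nonsing_inv_mul _ hu]

/-- The factor `z⁻¹` has modulus one and cancels, so `G` may be replaced by `K`, which is
holomorphic on the closed disc. -/
theorem G_congr (Y : Matrix (Fin n) (Fin n) ℂ) (z : Circle) :
    (S.G z)ᴴ * Y * S.G z = (S.K (z : ℂ)⁻¹)ᴴ * Y * S.K (z : ℂ)⁻¹ := by
  have h : ((z : ℂ)⁻¹) * star ((z : ℂ)⁻¹) = 1 := by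
    change _ * (starRingEnd ℂ) _ = 1
    rw [Complex.mul_conj]
    simp [Complex.normSq_eq_norm_sq, Circle.norm_coe]
  rw [G_eq, Matrix.conjTranspose_smul, Matrix.smul_mul, Matrix.smul_mul, Matrix.mul_smul,
    smul_smul, mul_comm (star _), h, one_smul]

theorem differentiableAt_K {l : ℕ} (Z : Matrix (Fin l) (Fin n) ℂ) {w : ℂ} (hw : ‖w‖ ≤ 1)
    (i : Fin l) (j : Fin m) : DifferentiableAt ℂ (fun w => (Z * S.K w) i j) w := by
  refine differentiableAt_mul (F := fun _ => Z) (fun _ _ => differentiableAt_const _) ?_ i j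
  refine differentiableAt_mul (F' := fun _ => S.B)
    (differentiableAt_inv (fun p q => ?_) (S.stable.det_ne_zero hw)) (fun _ _ => differentiableAt_const _)
  simp only [Matrix.sub_apply, Matrix.smul_apply, smul_eq_mul]
  fun_prop

theorem mul_reachability_eq_zero {l : ℕ} {Z : Matrix (Fin l) (Fin n) ℂ}
    (h : ∀ k, Z * S.A ^ k * S.B = 0) : Z = 0 := by
  have h0 : Z * reachabilityMatrix S.A S.B = 0 := by
    ext i p
    have := congrFun (congrFun (h p.1) i) p.2
    rw [Matrix.mul_assoc] at this
    simpa [Matrix.mul_apply, reachabilityMatrix] using this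
  have hr : LinearMap.range (reachabilityMatrix S.A S.B).mulVecLin = ⊤ := by
    apply Submodule.eq_top_of_finrank_eq
    rw [← Matrix.rank, S.reachable]
    simp
  apply Matrix.toLin'.injective
  rw [map_zero]
  apply LinearMap.ext
  intro x
  obtain ⟨y, rfl⟩ := LinearMap.range_eq_top.1 hr x
  rw [Matrix.mulVecLin_apply, Matrix.toLin'_apply, Matrix.mulVec_mulVec, h0, Matrix.zero_mulVec,
    LinearMap.zero_apply]

/-- A row combination of `(I - w A)⁻¹ B` that vanishes on the unit circle is trivial. -/
theorem eq_zero_of_mul_K {l : ℕ} {Z : Matrix (Fin l) (Fin n) ℂ}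
    (h : ∀ w : ℂ, ‖w‖ = 1 → Z * S.K w = 0) : Z = 0 := by
  have hin {Z : Matrix (Fin l) (Fin n) ℂ} (h : ∀ w : ℂ, ‖w‖ = 1 → Z * S.K w = 0) :
      Z * S.B = 0 := by
    rw [← K_zero]
    ext i j
    have := norm_le_of_norm_le_on_circle (fun w hw => S.differentiableAt_K Z hw i j)
      (c := 0) (fun w hw => by rw [h w hw]; simp) (w := 0) (by simp)
    simpa using this
  -- Vanishing on the circle forces `ZB = 0`, the value at the origin. Then `ZK = w ZAK`, so `ZA`
  -- satisfies the same hypothesis and reachability applies.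
  have hk (k : ℕ) : ∀ w : ℂ, ‖w‖ = 1 → Z * S.A ^ k * S.K w = 0 := by
    induction k with
    | zero => simpa using h
    | succ k ih =>
      intro w hw
      have h1 := ih w hw
      rw [S.K_eq hw.le, Matrix.mul_add, hin ih, zero_add, Matrix.mul_smul,
        ← Matrix.mul_assoc, Matrix.mul_assoc Z, ← pow_succ] at h1
      exact (smul_eq_zero.1 h1).resolve_left fun h0 => by simp [h0] at hw
  exact S.mul_reachability_eq_zero fun k => hin (hk k)

/-- The function `E = ZK - F₀/2` is skew-Hermitian on the circle and Hermitian at `0`. So `f = tr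
E²` has real part `-‖E‖² ≤ 0` on the circle and `‖E‖² ≥ 0` at `0`. The maximum principle for `exp f`
gives `E(0) = 0`; the maximum is then attained at an interior point, so `|exp f|` is constant and `E
= 0` on the circle. -/
theorem eq_zero_of_mul_K_add_conjTranspose {Z : Matrix (Fin m) (Fin n) ℂ}
    (h : ∀ w : ℂ, ‖w‖ = 1 → Z * S.K w + (Z * S.K w)ᴴ = Z * S.B) : Z = 0 := by
  set F₀ := Z * S.B with hF₀
  have hherm : F₀ᴴ = F₀ := by
    rw [← h 1 (by simp)]
    simp [add_comm]
  let E : ℂ → Matrix (Fin m) (Fin m) ℂ := fun w => Z * S.K w - (2 : ℂ)⁻¹ • F₀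
  have hE0 : E 0 = (2 : ℂ)⁻¹ • F₀ := by
    simp only [E, K_zero, ← hF₀]
    module
  have hEskew (w : ℂ) (hw : ‖w‖ = 1) : E w = -(E w)ᴴ := by
    have h1 : (Z * S.K w)ᴴ = F₀ - Z * S.K w := by rw [← h w hw]; abel
    simp only [E, Matrix.conjTranspose_sub, h1, Matrix.conjTranspose_smul, hherm]
    have : star (2 : ℂ)⁻¹ = (2 : ℂ)⁻¹ := by simp
    rw [this]
    module
  let f : ℂ → ℂ := fun w => (E w * E w).trace
  have hEd (w : ℂ) (hw : ‖w‖ ≤ 1) (i j) : DifferentiableAt ℂ (fun w => E w i j) w := by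
    simp only [E, Matrix.sub_apply]
    exact (S.differentiableAt_K Z hw i j).sub_const _
  have hfd (w : ℂ) (hw : ‖w‖ ≤ 1) : DifferentiableAt ℂ (fun w => Complex.exp (f w)) w := by
    refine DifferentiableAt.cexp ?_
    simp only [f, Matrix.trace, Matrix.diag]
    exact DifferentiableAt.fun_sum fun i _ =>
      differentiableAt_mul (hEd w hw) (hEd w hw) i i
  have hf1 (w : ℂ) (hw : ‖w‖ = 1) : (f w).re = -((E w)ᴴ * E w).trace.re := by
    have : f w = -((E w)ᴴ * E w).trace := by
      simp only [f]
      nth_rewrite 1 [hEskew w hw]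
      rw [Matrix.neg_mul, Matrix.trace_neg]
    rw [this, Complex.neg_re]
  have hf0 : (f 0).re = ((E 0)ᴴ * E 0).trace.re := by
    have h2 : (E 0)ᴴ = E 0 := by
      rw [hE0, Matrix.conjTranspose_smul, hherm]
      simp
    rw [h2]
  have hbd (w : ℂ) (hw : ‖w‖ ≤ 1) : ‖Complex.exp (f w)‖ ≤ 1 := by
    refine norm_le_of_norm_le_on_circle (f := fun w => Complex.exp (f w)) hfd
      (fun w hw => ?_) hw
    rw [Complex.norm_exp, Real.exp_le_one_iff, hf1 w hw]
    linarith [conjTranspose_mul_trace_nonneg (E w)]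
  have hE00 : E 0 = 0 := by
    refine eq_zero_of_conjTranspose_mul_trace ?_
    have := hbd 0 (by simp)
    rwa [Complex.norm_exp, Real.exp_le_one_iff, hf0] at this
  have hf00 : ‖Complex.exp (f 0)‖ = 1 := by simp [f, hE00]
  have hF00 : F₀ = 0 := by
    rw [hE0] at hE00
    exact (smul_eq_zero.1 hE00).resolve_left (by norm_num)
  have hmax := Complex.norm_eqOn_closedBall_of_isMaxOn (diffContOnCl_unitBall hfd)
    (z := 0) (fun w hw => by
      have := hbd w (by simpa using (Metric.mem_ball.1 hw).le)
      simpa [hf00] using this)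
  refine S.eq_zero_of_mul_K fun w hw => ?_
  have h1 : ‖Complex.exp (f w)‖ = 1 := by
    have := hmax (show w ∈ Metric.closedBall (0 : ℂ) 1 by simpa using hw.le)
    simpa [hf00] using this
  have h2 : E w = 0 := by
    refine eq_zero_of_conjTranspose_mul_trace ?_
    rw [Complex.norm_exp, Real.exp_eq_one_iff, hf1 w hw] at h1
    linarith
  simpa [E, hF00] using h2

/-- Substitute `wAK = K - B`: on the circle `K*A*XAK = (K - B)*X(K - B)`. -/
theorem popov_identity (X : Matrix (Fin n) (Fin n) ℂ) {w : ℂ} (hw : ‖w‖ = 1) :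
    (S.K w)ᴴ * (X - S.Aᴴ * X * S.A) * S.K w
      = (S.K w)ᴴ * X * S.B + S.Bᴴ * X * S.K w - S.Bᴴ * X * S.B := by
  have h1 : w • (S.A * S.K w) = S.K w - S.B := by rw [eq_sub_iff_add_eq', ← S.K_eq hw.le]
  have hww : star w * w = 1 := by
    change (starRingEnd ℂ) w * w = 1
    rw [mul_comm, Complex.mul_conj, Complex.normSq_eq_norm_sq, hw]
    simp
  have h2 : (S.K w)ᴴ * (S.Aᴴ * X * S.A) * S.K w = (S.K w - S.B)ᴴ * X * (S.K w - S.B) := by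
    rw [← h1, Matrix.conjTranspose_smul, Matrix.smul_mul, Matrix.smul_mul, Matrix.mul_smul,
      smul_smul, hww, one_smul, Matrix.conjTranspose_mul]
    simp only [Matrix.mul_assoc]
  rw [Matrix.mul_sub, Matrix.sub_mul, h2]
  simp only [Matrix.conjTranspose_sub, Matrix.sub_mul, Matrix.mul_sub]
  abel

theorem mul_B_eq_zero {X : Matrix (Fin n) (Fin n) ℂ} (hX : X.IsHermitian) (hB : S.Bᴴ * X = 0) :
    X * S.B = 0 := by
  rw [← hX.eq, ← Matrix.conjTranspose_conjTranspose S.B, ← Matrix.conjTranspose_mul, hB,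
    Matrix.conjTranspose_zero]

theorem G_congr_eq_zero {X : Matrix (Fin n) (Fin n) ℂ} (hX : X.IsHermitian) (hB : S.Bᴴ * X = 0)
    (z : Circle) : (S.G z)ᴴ * (X - S.Aᴴ * X * S.A) * S.G z = 0 := by
  rw [G_congr, S.popov_identity X (by simp [Circle.norm_coe]), Matrix.mul_assoc _ X, S.mul_B_eq_zero hX hB, hB]
  simp

/-- Take `X` from the Stein equation. The Popov identity turns the hypothesis into the relation of
`eq_zero_of_mul_K_add_conjTranspose` for `Z = B*X`. -/
theorem exists_of_G_congr_eq_zero {Y : Matrix (Fin n) (Fin n) ℂ} (hY : Y.IsHermitian)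
    (h : ∀ z : Circle, (S.G z)ᴴ * Y * S.G z = 0) :
    ∃ X : Matrix (Fin n) (Fin n) ℂ, X.IsHermitian ∧ S.Bᴴ * X = 0 ∧ X - S.Aᴴ * X * S.A = Y := by
  obtain ⟨X, hX, hXY⟩ := S.stable.exists_stein hY
  refine ⟨X, hX, S.eq_zero_of_mul_K_add_conjTranspose fun w hw => ?_, hXY⟩
  obtain ⟨z, rfl⟩ := exists_circle_inv_eq hw
  have h1 := S.popov_identity X hw
  rw [hXY, ← G_congr, h z] at h1
  rw [Matrix.conjTranspose_mul, Matrix.conjTranspose_mul, hX.eq, Matrix.conjTranspose_conjTranspose,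
    ← Matrix.mul_assoc, add_comm]
  exact sub_eq_zero.1 h1.symm

/-! ### The orthogonal complement of the range of `Γ` -/

section Range

theorem mem_imΓ {Λ : Matrix (Fin n) (Fin n) ℂ} : Λ ∈ S.imΓ ↔ ∃ Φ, (S.Γ Φ : Matrix _ _ ℂ) = Λ := by
  simp [imΓ]

theorem isHermitian_of_mem_imΓ {Λ : Matrix (Fin n) (Fin n) ℂ} (h : Λ ∈ S.imΓ) :
    Λ.IsHermitian := by
  obtain ⟨Φ, rfl⟩ := S.mem_imΓ.1 h
  exact (S.Γ Φ).2

/-- This computes the adjoint of `Γ`, which sends `Y` to the function `G*YG`. -/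
theorem inner_Γ {Y : Matrix (Fin n) (Fin n) ℂ} (hY : Y.IsHermitian) (Φ : C(Circle, Herm m)) :
    inner ℝ Y (S.Γ Φ : Matrix (Fin n) (Fin n) ℂ) = (2 * Real.pi)⁻¹ *
      ∫ θ in (-Real.pi)..Real.pi,
        (((S.G (Circle.exp θ))ᴴ * Y * S.G (Circle.exp θ)) *
          (Φ (Circle.exp θ) : Matrix (Fin m) (Fin m) ℂ)).trace.re := by
  let T : Herm n →L[ℝ] ℝ := (innerSL ℝ Y).comp (Herm n).subtypeL
  have hT (z : Circle) (X : Herm m) : T (S.integrand z X)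
      = (Yᴴ * (S.G z * (X : Matrix (Fin m) (Fin m) ℂ) * (S.G z)ᴴ)).trace.re := rfl
  change T ((2 * Real.pi)⁻¹ • _) = _
  rw [map_smul, smul_eq_mul, ← T.intervalIntegral_comp_comm
    ((S.continuous_integrand Φ).intervalIntegrable _ _)]
  congr 2
  funext θ
  rw [hT, hY.eq, ← Matrix.mul_assoc, Matrix.trace_mul_comm]
  simp only [Matrix.mul_assoc]

theorem mem_orthogonal_imΓ_iff {Y : Matrix (Fin n) (Fin n) ℂ} (hY : Y.IsHermitian) :
    Y ∈ S.imΓᗮ ↔ ∀ z : Circle, (S.G z)ᴴ * Y * S.G z = 0 := by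
  have hinner : Y ∈ S.imΓᗮ ↔ ∀ Φ, inner ℝ Y (S.Γ Φ : Matrix (Fin n) (Fin n) ℂ) = 0 := by
    rw [Submodule.mem_orthogonal']
    refine ⟨fun h Φ => h _ (S.mem_imΓ.2 ⟨Φ, rfl⟩), fun h u hu => ?_⟩
    obtain ⟨Φ, rfl⟩ := S.mem_imΓ.1 hu
    exact h Φ
  rw [hinner]
  constructor
  · intro h
    have hherm (z : Circle) : ((S.G z)ᴴ * Y * S.G z).IsHermitian :=
      Matrix.isHermitian_conjTranspose_mul_mul _ hY
    have hcont : Continuous fun z : Circle => (S.G z)ᴴ * Y * S.G z :=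
      (S.continuous_G.matrix_conjTranspose.matrix_mul continuous_const).matrix_mul S.continuous_G
    -- With the test function `Φ = G*YG` the integrand is `‖G*YG‖²`.
    let Φ : C(Circle, Herm m) := ⟨fun z => ⟨_, hherm z⟩, hcont.subtype_mk _⟩
    have h1 := h Φ
    rw [S.inner_Γ hY] at h1
    have h2 := (mul_eq_zero.1 h1).resolve_left (by positivity)
    intro z
    by_contra hz
    obtain ⟨t, ht, rfl⟩ : ∃ t ∈ Set.Icc (-Real.pi) Real.pi, Circle.exp t = z :=
      ⟨Complex.arg z, ⟨(Complex.neg_pi_lt_arg _).le, Complex.arg_le_pi _⟩, Circle.exp_arg z⟩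
    have hnn (θ : ℝ) : 0 ≤ (((S.G (Circle.exp θ))ᴴ * Y * S.G (Circle.exp θ)) *
          (Φ (Circle.exp θ) : Matrix (Fin m) (Fin m) ℂ)).trace.re := by
      have := conjTranspose_mul_trace_nonneg ((S.G (Circle.exp θ))ᴴ * Y * S.G (Circle.exp θ))
      rwa [(hherm _).eq] at this
    refine absurd h2 (ne_of_gt ?_)
    refine intervalIntegral.integral_pos (by linarith [Real.pi_pos]) ?_ (fun θ _ => hnn θ)
      ⟨t, ht, ?_⟩
    · have hc : Continuous fun θ : ℝ => (S.G (Circle.exp θ : ℂ))ᴴ * Y * S.G (Circle.exp θ : ℂ) :=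
        hcont.comp Circle.exp.continuous
      exact (Complex.continuous_re.comp (hc.matrix_mul hc).matrix_trace).continuousOn
    · refine (hnn t).lt_of_ne' fun h0 => hz ?_
      refine eq_zero_of_conjTranspose_mul_trace ?_
      rw [(hherm _).eq]
      exact h0.le
  · intro h Φ
    rw [S.inner_Γ hY]
    simp only [h, Matrix.zero_mul, Matrix.trace_zero, Complex.zero_re,
      intervalIntegral.integral_zero, mul_zero]

theorem hInv_eq_iff {C : S.𝔠} {Λ : S.imΓ} : S.hInv C = Λ ↔
    ∀ z : Circle, (S.G z)ᴴ * (Λ : Matrix (Fin n) (Fin n) ℂ) * S.G z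
      = (S.G z)ᴴ * (C : Matrix (Fin m) (Fin n) ℂ)ᴴ * (C : Matrix (Fin m) (Fin n) ℂ) * S.G z := by
  have h1 : S.hInv C = Λ ↔ ((C : Matrix (Fin m) (Fin n) ℂ)ᴴ * (C : Matrix (Fin m) (Fin n) ℂ)
      - (Λ : Matrix (Fin n) (Fin n) ℂ)) ∈ S.imΓᗮ := by
    rw [← Submodule.orthogonalProjectionOnto_eq_zero_iff, map_sub,
      Submodule.orthogonalProjectionOnto_mem_subspace_eq_self, sub_eq_zero]
    rfl
  rw [h1, S.mem_orthogonal_imΓ_iff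
    ((Matrix.isHermitian_conjTranspose_mul_self _).sub (S.isHermitian_of_mem_imΓ Λ.2))]
  refine forall_congr' fun z => ?_
  rw [Matrix.mul_sub, Matrix.sub_mul, sub_eq_zero, eq_comm, ← Matrix.mul_assoc]

theorem hInv_spec (C : S.𝔠) (z : Circle) :
    (S.G z)ᴴ * (S.hInv C : Matrix (Fin n) (Fin n) ℂ) * S.G z
      = (S.G z)ᴴ * (C : Matrix (Fin m) (Fin n) ℂ)ᴴ * (C : Matrix (Fin m) (Fin n) ℂ) * S.G z :=
  S.hInv_eq_iff.1 rfl z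

theorem hInv_eq_iff_exists {C : S.𝔠} {Λ : S.imΓ} : S.hInv C = Λ ↔
    ∃ X : Matrix (Fin n) (Fin n) ℂ, X.IsHermitian ∧ S.Bᴴ * X = 0 ∧
      X - S.Aᴴ * X * S.A = (C : Matrix (Fin m) (Fin n) ℂ)ᴴ * (C : Matrix (Fin m) (Fin n) ℂ)
        - (Λ : Matrix (Fin n) (Fin n) ℂ) := by
  rw [S.hInv_eq_iff]
  constructor
  · intro h
    refine S.exists_of_G_congr_eq_zero
      ((Matrix.isHermitian_conjTranspose_mul_self _).sub (S.isHermitian_of_mem_imΓ Λ.2))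
      fun z => ?_
    rw [Matrix.mul_sub, Matrix.sub_mul, h z, ← Matrix.mul_assoc, sub_self]
  · rintro ⟨X, hX, hB, h⟩ z
    have h2 := S.G_congr_eq_zero hX hB z
    rw [h, Matrix.mul_sub, Matrix.sub_mul, sub_eq_zero, ← Matrix.mul_assoc] at h2
    exact h2.symm

end Range

/-! ### The closed-loop matrix and the zeros of the spectral factor -/

section ClosedLoop

/-- The closed-loop matrix `A - B (C B)⁻¹ C A`. -/
def closedLoop (C : Matrix (Fin m) (Fin n) ℂ) : Matrix (Fin n) (Fin n) ℂ :=
  S.A - S.B * (C * S.B)⁻¹ * C * S.A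

variable {C : Matrix (Fin m) (Fin n) ℂ}

theorem mul_closedLoop (h : IsUnit (C * S.B)) : C * S.closedLoop C = 0 := by
  rw [closedLoop, Matrix.mul_sub]
  have : C * (S.B * (C * S.B)⁻¹ * C * S.A) = (C * S.B) * (C * S.B)⁻¹ * (C * S.A) := by
    simp only [Matrix.mul_assoc]
  rw [this, Matrix.mul_nonsing_inv _ ((Matrix.isUnit_iff_isUnit_det _).1 h), Matrix.one_mul,
    sub_self]

theorem mul_closedLoop_of_mul_B {X : Matrix (Fin n) (Fin n) ℂ} (h : X * S.B = 0) :
    X * S.closedLoop C = X * S.A := by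
  rw [closedLoop, Matrix.mul_sub, ← Matrix.mul_assoc, ← Matrix.mul_assoc, ← Matrix.mul_assoc, h]
  simp

theorem closedLoop_congr {X : Matrix (Fin n) (Fin n) ℂ} (hX : X.IsHermitian)
    (hB : S.Bᴴ * X = 0) :
    (S.closedLoop C)ᴴ * X * S.closedLoop C = S.Aᴴ * X * S.A := by
  have h := S.mul_closedLoop_of_mul_B (C := C) (S.mul_B_eq_zero hX hB)
  have h' := congrArg Matrix.conjTranspose h
  rw [Matrix.conjTranspose_mul, Matrix.conjTranspose_mul, hX.eq] at h'
  rw [Matrix.mul_assoc, h, ← Matrix.mul_assoc, h']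

/-- Factor `CK = CB(1 + w(CB)⁻¹CA(1 - wA)⁻¹B)` and move `B` to the left inside the determinant by
Sylvester's identity. The zeros of `det CK` in the disc are thus those of `det(1 - wF)`, with `F`
the closed-loop matrix. -/
theorem det_mul_K {w : ℂ} (h : IsUnit (C * S.B)) (hw : ‖w‖ ≤ 1) :
    (C * S.K w).det * (1 - w • S.A).det = (C * S.B).det * (1 - w • S.closedLoop C).det := by
  have hu := (Matrix.isUnit_iff_isUnit_det _).1 h
  have hA : IsUnit (1 - w • S.A).det := isUnit_iff_ne_zero.2 (S.stable.det_ne_zero hw)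
  have h1 : C * S.K w = (C * S.B) * (1 + (w • ((C * S.B)⁻¹ * C * S.A * (1 - w • S.A)⁻¹)) * S.B) := by
    rw [Matrix.mul_add, Matrix.mul_one, S.K_eq hw, Matrix.mul_add]
    congr 1
    rw [K, Matrix.smul_mul, Matrix.mul_smul, Matrix.mul_smul]
    congr 1
    simp only [← Matrix.mul_assoc]
    rw [Matrix.mul_nonsing_inv _ hu, Matrix.one_mul]
  rw [h1, Matrix.det_mul, Matrix.det_one_add_mul_comm, mul_assoc, ← Matrix.det_mul, Matrix.add_mul,
    Matrix.one_mul, Matrix.mul_smul, Matrix.smul_mul, ← Matrix.mul_assoc S.B,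
    Matrix.mul_assoc _ _ (1 - w • S.A), Matrix.nonsing_inv_mul _ hA]
  congr 2
  rw [closedLoop, smul_sub, Matrix.mul_one]
  simp only [Matrix.mul_assoc]
  abel

theorem closedLoop_stable_iff (h : IsUnit (C * S.B)) :
    IsSchurStable (S.closedLoop C) ↔ ∀ w : ℂ, ‖w‖ ≤ 1 → (C * S.K w).det ≠ 0 := by
  rw [isSchurStable_iff_det_ne_zero]
  refine forall₂_congr fun w hw => not_congr ?_
  have h1 := S.det_mul_K h hw
  have h2 := ((Matrix.isUnit_iff_isUnit_det _).1 h).ne_zero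
  have h3 := S.stable.det_ne_zero hw
  constructor
  · intro h0
    rw [h0, mul_zero] at h1
    exact (mul_eq_zero.1 h1).resolve_right h3
  · intro h0
    rw [h0, zero_mul] at h1
    exact (mul_eq_zero.1 h1.symm).resolve_left h2

/-- Only weak positivity of the diagonal is required: `det CK(0) = det CB ≠ 0` makes it strict. The
weak inequality is what survives a passage to the limit. -/
theorem mem_CPlus_iff {C : S.𝔠} : C ∈ S.CPlus ↔
    (∀ i, 0 ≤ (((C : Matrix (Fin m) (Fin n) ℂ) * S.B) i i).re) ∧
      ∀ w : ℂ, ‖w‖ ≤ 1 → ((C : Matrix (Fin m) (Fin n) ℂ) * S.K w).det ≠ 0 := by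
  constructor
  · rintro ⟨h1, h2⟩
    exact ⟨fun i => (h1.2 i).2.le, (S.closedLoop_stable_iff h1.isUnit).1 h2⟩
  · rintro ⟨h1, h2⟩
    have h3 : IsLowerPos ((C : Matrix (Fin m) (Fin n) ℂ) * S.B) := by
      refine ⟨C.2.1, fun i => ⟨C.2.2 i, (h1 i).lt_of_ne' fun h0 => ?_⟩⟩
      have h4 := h2 0 (by simp)
      rw [K_zero, det_of_lower C.2.1, Finset.prod_ne_zero_iff] at h4
      exact h4 i (Finset.mem_univ _) (Complex.ext h0 (C.2.2 i))
    exact ⟨h3, (S.closedLoop_stable_iff h3.isUnit).2 h2⟩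

theorem hInv_mem_LPlusΓ {C : S.𝔠} (hC : C ∈ S.CPlus) : S.hInv C ∈ S.LPlusΓ := by
  refine ⟨S.isHermitian_of_mem_imΓ (S.hInv C).2, fun z => ?_⟩
  rw [hInv_spec, ← Matrix.conjTranspose_mul, Matrix.mul_assoc]
  refine Matrix.PosDef.conjTranspose_mul_self _ ?_
  rw [Matrix.mulVec_injective_iff_isUnit, Matrix.isUnit_iff_isUnit_det, isUnit_iff_ne_zero,
    G_eq, Matrix.mul_smul, Matrix.det_smul]
  exact mul_ne_zero (pow_ne_zero _ (inv_ne_zero (Circle.coe_ne_zero z)))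
    ((S.mem_CPlus_iff.1 hC).2 _ (by simp [Circle.norm_coe]))

end ClosedLoop

/-! ### Spectral factors and the Riccati equation -/

section Riccati

variable {Λ P : Matrix (Fin n) (Fin n) ℂ}

/-- The Riccati equation has at most one stabilizing solution. -/
theorem IsStabilizingSolution.unique {P P' : Matrix (Fin n) (Fin n) ℂ}
    (h : S.IsStabilizingSolution Λ P) (h' : S.IsStabilizingSolution Λ P') : P = P' := by
  have key {P : Matrix (Fin n) (Fin n) ℂ} (h : S.IsStabilizingSolution Λ P) :
      ∃ F : Matrix (Fin m) (Fin n) ℂ, IsSchurStable (S.A - S.B * F) ∧ S.Bᴴ * P * (S.A - S.B * F) = 0 ∧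
        P = S.Aᴴ * P * (S.A - S.B * F) + Λ := by
    refine ⟨(S.Bᴴ * P * S.B)⁻¹ * S.Bᴴ * P * S.A, ?_, ?_, ?_⟩
    · simpa only [Matrix.mul_assoc] using h.stable
    · have := Matrix.mul_nonsing_inv _ ((Matrix.isUnit_iff_isUnit_det _).1 h.isUnit)
      rw [Matrix.mul_sub, ← Matrix.mul_assoc, ← Matrix.mul_assoc, ← Matrix.mul_assoc,
        ← Matrix.mul_assoc, this]
      simp [Matrix.mul_assoc]
    · rw [Matrix.mul_sub]
      simpa only [Matrix.mul_assoc] using h.riccati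
  obtain ⟨F, hs, hB, hP⟩ := key h
  obtain ⟨F', hs', hB', hP'⟩ := key h'
  have hΛ : Λᴴ = Λ := by
    have h1 : Λ = P - S.Aᴴ * P * (S.A - S.B * F) := by rw [eq_sub_iff_add_eq', ← hP]
    have h2 : P - S.Aᴴ * P * (S.A - S.B * F)
        = P - (S.A - S.B * F)ᴴ * P * (S.A - S.B * F) := by
      rw [Matrix.conjTranspose_sub, Matrix.conjTranspose_mul, Matrix.sub_mul, Matrix.sub_mul,
        Matrix.mul_assoc Fᴴ, Matrix.mul_assoc Fᴴ, hB]
      simp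
    rw [h1, h2]
    exact (h.isHermitian.sub (Matrix.isHermitian_conjTranspose_mul_mul _ h.isHermitian)).eq
  -- Since `B*P(A - BF) = 0`, the left factor `A*` may be replaced by `(A - BF')*`; the adjoint
  -- argument for `P'` gives the same mixed equation. The difference `P - P'` then solves a
  -- homogeneous Stein equation.
  have e1 : P = (S.A - S.B * F')ᴴ * P * (S.A - S.B * F) + Λ := by
    rw [Matrix.conjTranspose_sub, Matrix.conjTranspose_mul, Matrix.sub_mul, Matrix.sub_mul,
      Matrix.mul_assoc F'ᴴ, Matrix.mul_assoc F'ᴴ, hB]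
    simpa using hP
  have e2 : P' = (S.A - S.B * F')ᴴ * P' * (S.A - S.B * F) + Λ := by
    have h3 := congrArg Matrix.conjTranspose hP'
    have h4 := congrArg Matrix.conjTranspose hB'
    rw [Matrix.conjTranspose_add, Matrix.conjTranspose_mul, Matrix.conjTranspose_mul,
      h'.isHermitian.eq, hΛ, Matrix.conjTranspose_conjTranspose] at h3
    rw [Matrix.conjTranspose_mul, Matrix.conjTranspose_mul, h'.isHermitian.eq,
      Matrix.conjTranspose_conjTranspose, Matrix.conjTranspose_zero] at h4
    rw [Matrix.mul_sub, ← Matrix.mul_assoc _ S.B, Matrix.mul_assoc _ P' S.B, h4, Matrix.zero_mul,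
      sub_zero]
    simpa only [Matrix.mul_assoc] using h3
  refine sub_eq_zero.1 (hs.eq_zero_of_stein hs' ?_)
  rw [Matrix.mul_sub (S.A - S.B * F')ᴴ P P', Matrix.sub_mul _ _ (S.A - S.B * F), eq_comm]
  calc _ = ((S.A - S.B * F')ᴴ * P * (S.A - S.B * F) + Λ)
        - ((S.A - S.B * F')ᴴ * P' * (S.A - S.B * F) + Λ) := by abel
    _ = P - P' := by rw [← e1, ← e2]

/-- As `B*X = 0`, the matrix `P = C*C - X` has `B*P = (CB)*C`. So the Riccati gain is `(CB)⁻¹CA`,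
and the quadratic term collapses to `A*C*CA`. -/
theorem isStabilizingSolution_of_factor {C : Matrix (Fin m) (Fin n) ℂ}
    {X : Matrix (Fin n) (Fin n) ℂ} (hC : IsLowerPos (C * S.B))
    (hs : IsSchurStable (S.closedLoop C)) (hX : X.IsHermitian) (hB : S.Bᴴ * X = 0)
    (hΛ : X - S.Aᴴ * X * S.A = Cᴴ * C - Λ) :
    S.IsStabilizingSolution Λ (Cᴴ * C - X) ∧
      S.Bᴴ * (Cᴴ * C - X) * S.B = (C * S.B)ᴴ * (C * S.B) ∧
      C = ((C * S.B)ᴴ)⁻¹ * S.Bᴴ * (Cᴴ * C - X) := by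
  have hu := (Matrix.isUnit_iff_isUnit_det _).1 hC.isUnit
  have hu' : IsUnit ((C * S.B)ᴴ).det := by rw [Matrix.det_conjTranspose]; exact hu.star
  have h1 : S.Bᴴ * (Cᴴ * C - X) = (C * S.B)ᴴ * C := by
    rw [Matrix.mul_sub, hB, sub_zero, Matrix.conjTranspose_mul, Matrix.mul_assoc]
  have h2 : S.Bᴴ * (Cᴴ * C - X) * S.B = (C * S.B)ᴴ * (C * S.B) := by
    rw [h1, Matrix.mul_assoc]
  have h3 : (S.Bᴴ * (Cᴴ * C - X) * S.B)⁻¹ * (S.Bᴴ * (Cᴴ * C - X)) = (C * S.B)⁻¹ * C := by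
    rw [h2, h1, Matrix.mul_inv_rev, Matrix.mul_assoc, ← Matrix.mul_assoc (((C * S.B)ᴴ)⁻¹),
      Matrix.nonsing_inv_mul _ hu', Matrix.one_mul]
  have hP : (Cᴴ * C - X).IsHermitian := (Matrix.isHermitian_conjTranspose_mul_self _).sub hX
  have h4 : (Cᴴ * C - X) * S.B = Cᴴ * (C * S.B) := by
    rw [Matrix.sub_mul, S.mul_B_eq_zero hX hB, sub_zero, Matrix.mul_assoc]
  refine ⟨⟨hP, ?_, ?_, ?_⟩, h2, ?_⟩
  · rw [h2, Matrix.isUnit_iff_isUnit_det, Matrix.det_mul]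
    exact hu'.mul hu
  · have h5 : S.Aᴴ * (Cᴴ * C - X) * S.B * (S.Bᴴ * (Cᴴ * C - X) * S.B)⁻¹ * S.Bᴴ * (Cᴴ * C - X) * S.A
        = S.Aᴴ * (Cᴴ * C) * S.A := by
      calc _ = S.Aᴴ * ((Cᴴ * C - X) * S.B) *
            ((S.Bᴴ * (Cᴴ * C - X) * S.B)⁻¹ * (S.Bᴴ * (Cᴴ * C - X))) * S.A := by
            simp only [Matrix.mul_assoc]
        _ = S.Aᴴ * Cᴴ * ((C * S.B) * (C * S.B)⁻¹) * (C * S.A) := by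
            rw [h3, h4]
            simp only [Matrix.mul_assoc]
        _ = _ := by
            rw [Matrix.mul_nonsing_inv _ hu]
            simp [Matrix.mul_assoc]
    rw [h5]
    have h6 : Λ = Cᴴ * C - (X - S.Aᴴ * X * S.A) := by rw [hΛ]; abel
    rw [h6, Matrix.mul_sub, Matrix.sub_mul]
    abel
  · have h5 : S.B * (S.Bᴴ * (Cᴴ * C - X) * S.B)⁻¹ * S.Bᴴ * (Cᴴ * C - X) * S.A
        = S.B * (C * S.B)⁻¹ * C * S.A := by
      calc _ = S.B * ((S.Bᴴ * (Cᴴ * C - X) * S.B)⁻¹ * (S.Bᴴ * (Cᴴ * C - X))) * S.A := by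
            simp only [Matrix.mul_assoc]
        _ = _ := by rw [h3]; simp only [Matrix.mul_assoc]
    rw [h5]
    exact hs
  · rw [Matrix.mul_assoc, h1, ← Matrix.mul_assoc, Matrix.nonsing_inv_mul _ hu', Matrix.one_mul]

theorem factor_of_isStabilizingSolution {L : Matrix (Fin m) (Fin m) ℂ}
    (h : S.IsStabilizingSolution Λ P) (hL : S.Bᴴ * P * S.B = Lᴴ * L) (hLp : IsLowerPos L)
    {C : Matrix (Fin m) (Fin n) ℂ} (hC : C = (Lᴴ)⁻¹ * S.Bᴴ * P) :
    C * S.B = L ∧ IsSchurStable (S.closedLoop C) ∧ (Cᴴ * C - P).IsHermitian ∧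
      S.Bᴴ * (Cᴴ * C - P) = 0 ∧
      (Cᴴ * C - P) - S.Aᴴ * (Cᴴ * C - P) * S.A = Cᴴ * C - Λ := by
  have hu := (Matrix.isUnit_iff_isUnit_det _).1 hLp.isUnit
  have hu' : IsUnit (Lᴴ).det := by rw [Matrix.det_conjTranspose]; exact hu.star
  have hCB : C * S.B = L := by
    rw [hC, Matrix.mul_assoc, Matrix.mul_assoc, ← Matrix.mul_assoc S.Bᴴ, hL, ← Matrix.mul_assoc,
      Matrix.nonsing_inv_mul _ hu', Matrix.one_mul]
  have hLC : Lᴴ * C = S.Bᴴ * P := by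
    rw [hC, Matrix.mul_assoc, ← Matrix.mul_assoc, Matrix.mul_nonsing_inv _ hu', Matrix.one_mul]
  have hinv : (S.Bᴴ * P * S.B)⁻¹ * (S.Bᴴ * P) = L⁻¹ * C := by
    rw [hL, ← hLC, Matrix.mul_inv_rev, Matrix.mul_assoc, ← Matrix.mul_assoc (Lᴴ)⁻¹,
      Matrix.nonsing_inv_mul _ hu', Matrix.one_mul]
  have hPB : P * S.B = Cᴴ * L := by
    have := congrArg Matrix.conjTranspose hLC
    rw [Matrix.conjTranspose_mul, Matrix.conjTranspose_mul, h.isHermitian.eq,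
      Matrix.conjTranspose_conjTranspose, Matrix.conjTranspose_conjTranspose] at this
    exact this.symm
  refine ⟨hCB, ?_, (Matrix.isHermitian_conjTranspose_mul_self _).sub h.isHermitian, ?_, ?_⟩
  · have h5 : S.B * (S.Bᴴ * P * S.B)⁻¹ * S.Bᴴ * P * S.A = S.B * (C * S.B)⁻¹ * C * S.A := by
      calc _ = S.B * ((S.Bᴴ * P * S.B)⁻¹ * (S.Bᴴ * P)) * S.A := by simp only [Matrix.mul_assoc]
        _ = _ := by rw [hinv, hCB]; simp only [Matrix.mul_assoc]
    have := h.stable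
    rw [h5] at this
    exact this
  · rw [Matrix.mul_sub, ← Matrix.mul_assoc, ← Matrix.conjTranspose_mul, hCB, hLC, sub_self]
  · have h5 : S.Aᴴ * P * S.B * (S.Bᴴ * P * S.B)⁻¹ * S.Bᴴ * P * S.A = S.Aᴴ * (Cᴴ * C) * S.A := by
      calc _ = S.Aᴴ * (P * S.B) * ((S.Bᴴ * P * S.B)⁻¹ * (S.Bᴴ * P)) * S.A := by
            simp only [Matrix.mul_assoc]
        _ = S.Aᴴ * Cᴴ * (L * L⁻¹) * (C * S.A) := by
            rw [hinv, hPB]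
            simp only [Matrix.mul_assoc]
        _ = _ := by
            rw [Matrix.mul_nonsing_inv _ hu]
            simp [Matrix.mul_assoc]
    have h6 : Λ = P - S.Aᴴ * P * S.A + S.Aᴴ * (Cᴴ * C) * S.A := by
      have h7 := h.riccati
      rw [h5] at h7
      calc Λ = (S.Aᴴ * P * S.A - S.Aᴴ * (Cᴴ * C) * S.A + Λ) - S.Aᴴ * P * S.A
            + S.Aᴴ * (Cᴴ * C) * S.A := by abel
        _ = _ := by rw [← h7]
    rw [h6, Matrix.mul_sub, Matrix.sub_mul]
    abel

theorem isSpectralFactor_iff {Λ : S.imΓ} {C : Matrix (Fin m) (Fin n) ℂ} :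
    S.IsSpectralFactor Λ C ↔ ∃ hC : C ∈ S.𝔠, ⟨C, hC⟩ ∈ S.CPlus ∧ S.hInv ⟨C, hC⟩ = Λ := by
  constructor
  · rintro ⟨P, L, hP, hL, hLp, hC⟩
    obtain ⟨h1, h2, h3, h4, h5⟩ := S.factor_of_isStabilizingSolution hP hL hLp hC
    have hCp : IsLowerPos (C * S.B) := h1 ▸ hLp
    exact ⟨hCp.isLowerReal, ⟨hCp, h2⟩, S.hInv_eq_iff_exists.2 ⟨_, h3, h4, h5⟩⟩
  · rintro ⟨hC, ⟨hCp, hs⟩, h⟩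
    obtain ⟨X, hX, hB, h1⟩ := S.hInv_eq_iff_exists.1 h
    obtain ⟨h2, h3, h4⟩ := S.isStabilizingSolution_of_factor hCp hs hX hB h1
    exact ⟨_, _, h2, h3, hCp, h4⟩

theorem IsSpectralFactor.unique {C C' : Matrix (Fin m) (Fin n) ℂ} (h : S.IsSpectralFactor Λ C)
    (h' : S.IsSpectralFactor Λ C') : C = C' := by
  obtain ⟨P, L, hP, hL, hLp, rfl⟩ := h
  obtain ⟨P', L', hP', hL', hLp', rfl⟩ := h'
  obtain rfl := IsStabilizingSolution.unique S hP hP'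
  obtain rfl := hLp.eq_of_mul_eq hLp' (hL.symm.trans hL')
  rfl

theorem injOn_hInv : Set.InjOn S.hInv S.CPlus := fun C hC C' hC' h =>
  Subtype.ext (IsSpectralFactor.unique S (Λ := S.hInv C')
    (S.isSpectralFactor_iff.2 ⟨C.2, hC, h⟩) (S.isSpectralFactor_iff.2 ⟨C'.2, hC', rfl⟩))

end Riccati

/-! ### Invertibility of the linearization -/

section Derivative

variable {C V : Matrix (Fin m) (Fin n) ℂ}

/-- Write `C*V + V*C = X - A*XA` with `B*X = 0`. Because `CF = 0` and `F*XF = A*XA` for the closed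
loop `F`, the matrix `D = C*V + V*C - X` satisfies `D = F*DF`, so `D = 0`. Multiplying by `B*` and
`B` makes `VB(CB)⁻¹` skew-Hermitian; being triangular with real diagonal, it vanishes. -/
theorem eq_zero_of_symmetrized_mem_orthogonal (hC : IsLowerPos (C * S.B))
    (hs : IsSchurStable (S.closedLoop C)) (hV : V ∈ S.𝔠) (h : Cᴴ * V + Vᴴ * C ∈ S.imΓᗮ) :
    V = 0 := by
  have hu := (Matrix.isUnit_iff_isUnit_det _).1 hC.isUnit
  have hu' : IsUnit ((C * S.B)ᴴ).det := by rw [Matrix.det_conjTranspose]; exact hu.star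
  have hherm : (Cᴴ * V + Vᴴ * C).IsHermitian := by
    rw [Matrix.IsHermitian, Matrix.conjTranspose_add, Matrix.conjTranspose_mul,
      Matrix.conjTranspose_mul, Matrix.conjTranspose_conjTranspose,
      Matrix.conjTranspose_conjTranspose, add_comm]
  obtain ⟨X, hX, hB, hXe⟩ := S.exists_of_G_congr_eq_zero hherm
    ((S.mem_orthogonal_imΓ_iff hherm).1 h)
  have hcl := S.mul_closedLoop hC.isUnit
  have hcl' : (S.closedLoop C)ᴴ * Cᴴ = 0 := by
    rw [← Matrix.conjTranspose_mul, hcl, Matrix.conjTranspose_zero]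
  have hD : Cᴴ * V + Vᴴ * C - X = 0 := by
    refine hs.eq_zero_of_stein hs ?_
    rw [Matrix.mul_sub, Matrix.sub_mul, S.closedLoop_congr hX hB, Matrix.mul_add, Matrix.add_mul,
      ← Matrix.mul_assoc, hcl', ← Matrix.mul_assoc, Matrix.mul_assoc _ C, hcl, ← hXe]
    simp
  have h1 : (C * S.B)ᴴ * V + (V * S.B)ᴴ * C = 0 := by
    have := congrArg (S.Bᴴ * ·) hD
    simpa [Matrix.mul_sub, Matrix.mul_add, hB, Matrix.mul_assoc] using this
  set N := V * S.B * (C * S.B)⁻¹ with hN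
  have hNB : N * (C * S.B) = V * S.B := by
    rw [hN, Matrix.mul_assoc, Matrix.nonsing_inv_mul _ hu, Matrix.mul_one]
  have hNr : IsLowerReal N := IsLowerReal.mul hV hC.inv.isLowerReal
  have hN0 : N = 0 := by
    refine hNr.eq_zero ?_
    have h2 : (C * S.B)ᴴ * (N + Nᴴ) * (C * S.B) = 0 := by
      have := congrArg (· * S.B) h1
      simp only [Matrix.add_mul, Matrix.zero_mul] at this
      rw [Matrix.mul_assoc, Matrix.mul_assoc _ C, ← hNB, Matrix.conjTranspose_mul N] at this
      rw [Matrix.mul_add, Matrix.add_mul, Matrix.mul_assoc, this]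
    have h3 := congrArg (fun Y => ((C * S.B)ᴴ)⁻¹ * Y * (C * S.B)⁻¹) h2
    simp only [Matrix.mul_zero, Matrix.zero_mul] at h3
    rwa [Matrix.mul_assoc ((C * S.B)ᴴ), ← Matrix.mul_assoc, Matrix.nonsing_inv_mul _ hu',
      Matrix.one_mul, Matrix.mul_assoc, Matrix.mul_nonsing_inv _ hu, Matrix.mul_one] at h3
  rw [← hNB, hN0, Matrix.zero_mul, Matrix.conjTranspose_zero, Matrix.zero_mul, add_zero] at h1
  have h4 := congrArg (((C * S.B)ᴴ)⁻¹ * ·) h1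
  simpa only [← Matrix.mul_assoc, Matrix.nonsing_inv_mul _ hu', Matrix.one_mul,
    Matrix.mul_zero] using h4

/-- The injectivity argument is run backwards: solve `D - F*DF = Λ`, then choose `V` so that `X =
C*V + V*C - D` has `B*X = 0`. -/
theorem exists_symmetrized_sub_mem_orthogonal (hC : IsLowerPos (C * S.B))
    (hs : IsSchurStable (S.closedLoop C)) {Λ : Matrix (Fin n) (Fin n) ℂ} (hΛ : Λ.IsHermitian) :
    ∃ V ∈ S.𝔠, Cᴴ * V + Vᴴ * C - Λ ∈ S.imΓᗮ := by
  have hu := (Matrix.isUnit_iff_isUnit_det _).1 hC.isUnit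
  have hu' : IsUnit ((C * S.B)ᴴ).det := by rw [Matrix.det_conjTranspose]; exact hu.star
  obtain ⟨D, hD, hDe⟩ := hs.exists_stein hΛ
  have hH : ((S.B * (C * S.B)⁻¹)ᴴ * D * (S.B * (C * S.B)⁻¹)).IsHermitian :=
    Matrix.isHermitian_conjTranspose_mul_mul _ hD
  obtain ⟨N, hN, hNe⟩ := exists_isLowerReal_add hH
  -- The condition `B*X = 0` reads `(CB)*V + (VB)*C = B*D`. If `VB = N(CB)`, solving for `V` gives
  -- this formula, and consistency requires exactly the splitting of `N + N*` chosen above.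
  obtain ⟨V, hV⟩ : ∃ V, V = ((C * S.B)ᴴ)⁻¹ * (S.Bᴴ * D) - Nᴴ * C := ⟨_, rfl⟩
  have hVB : V * S.B = N * (C * S.B) := by
    have h1 : ((C * S.B)ᴴ)⁻¹ * (S.Bᴴ * D) * S.B
        = (S.B * (C * S.B)⁻¹)ᴴ * D * (S.B * (C * S.B)⁻¹) * (C * S.B) := by
      rw [Matrix.mul_assoc _ (S.B * _), Matrix.mul_assoc S.B, Matrix.nonsing_inv_mul _ hu,
        Matrix.mul_one, Matrix.conjTranspose_mul S.B, Matrix.conjTranspose_nonsing_inv]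
      simp only [Matrix.mul_assoc]
    rw [hV, Matrix.sub_mul, h1, ← hNe, Matrix.mul_assoc, Matrix.add_mul]
    abel
  have hVc : V ∈ S.𝔠 := by
    change IsLowerReal (V * S.B)
    rw [hVB]
    exact hN.mul hC.isLowerReal
  have hcv : (C * S.B)ᴴ * V + (V * S.B)ᴴ * C = S.Bᴴ * D := by
    rw [hVB, hV, Matrix.mul_sub, ← Matrix.mul_assoc, Matrix.mul_nonsing_inv _ hu', Matrix.one_mul,
      Matrix.conjTranspose_mul N, Matrix.mul_assoc _ Nᴴ]
    abel
  have hherm : (Cᴴ * V + Vᴴ * C).IsHermitian := by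
    rw [Matrix.IsHermitian, Matrix.conjTranspose_add, Matrix.conjTranspose_mul,
      Matrix.conjTranspose_mul, Matrix.conjTranspose_conjTranspose,
      Matrix.conjTranspose_conjTranspose, add_comm]
  set X := Cᴴ * V + Vᴴ * C - D with hXdef
  have hX : X.IsHermitian := hherm.sub hD
  have hB : S.Bᴴ * X = 0 := by
    rw [hXdef, Matrix.mul_sub, ← hcv]
    simp [Matrix.mul_add, Matrix.mul_assoc]
  have hcl := S.mul_closedLoop hC.isUnit
  have hcl' : (S.closedLoop C)ᴴ * Cᴴ = 0 := by
    rw [← Matrix.conjTranspose_mul, hcl, Matrix.conjTranspose_zero]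
  have hXe : X - S.Aᴴ * X * S.A = Cᴴ * V + Vᴴ * C - Λ := by
    rw [← S.closedLoop_congr (C := C) hX hB, hXdef, ← hDe, Matrix.mul_sub, Matrix.sub_mul,
      Matrix.mul_add, Matrix.add_mul, ← Matrix.mul_assoc, hcl', ← Matrix.mul_assoc,
      Matrix.mul_assoc _ C, hcl]
    simp only [Matrix.zero_mul, Matrix.mul_zero, add_zero, zero_sub, sub_neg_eq_add]
    abel
  refine ⟨V, hVc, ?_⟩
  rw [S.mem_orthogonal_imΓ_iff (hherm.sub hΛ), ← hXe]
  exact S.G_congr_eq_zero hX hB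

end Derivative

end FilterBank

/-! ### A Lyapunov function and a point of `𝓒₊` -/

/-- Along an orbit `A^j v` the form of `Q` drops by `‖A^j v‖²` at each step and tends to `0`, so it
starts positive when `v ≠ 0`. -/
theorem exists_conjTranspose_mul_self_lt {k : ℕ} {A : Matrix (Fin k) (Fin k) ℂ}
    (hA : IsSchurStable A) :
    ∃ Q : Matrix (Fin k) (Fin k) ℂ, Q.PosDef ∧ Q - Aᴴ * Q * A = 1 := by
  obtain ⟨Q, hQ, hQe⟩ := hA.exists_stein (Matrix.isHermitian_one (n := Fin k) (α := ℂ))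
  refine ⟨Q, Matrix.PosDef.of_dotProduct_mulVec_pos hQ fun v hv => ?_, hQe⟩
  let a : ℕ → ℂ := fun j => star (A ^ j *ᵥ v) ⬝ᵥ (Q *ᵥ (A ^ j *ᵥ v))
  have ha (j : ℕ) : a j = star (A ^ j *ᵥ v) ⬝ᵥ (A ^ j *ᵥ v) + a (j + 1) := by
    have h1 : Q = 1 + Aᴴ * Q * A := by rw [← hQe]; abel
    have h2 : a (j + 1) = star (A ^ j *ᵥ v) ⬝ᵥ ((Aᴴ * Q * A) *ᵥ (A ^ j *ᵥ v)) := by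
      simp only [a]
      rw [pow_succ', ← Matrix.mulVec_mulVec, Matrix.star_mulVec, ← Matrix.dotProduct_mulVec,
        Matrix.mulVec_mulVec, Matrix.mulVec_mulVec, Matrix.mul_assoc]
    rw [h2, ← dotProduct_add]
    nth_rewrite 2 [← Matrix.one_mulVec (A ^ j *ᵥ v)]
    rw [← Matrix.add_mulVec, ← h1]
  have hanti : Antitone fun j => (a j).re := by
    refine antitone_nat_of_succ_le fun j => ?_
    have h1 := (Complex.le_def.1 (dotProduct_star_self_nonneg (A ^ j *ᵥ v))).1
    rw [ha j, Complex.add_re]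
    simp only [Complex.zero_re] at h1
    linarith
  have hlim : Tendsto (fun j => (a j).re) atTop (𝓝 0) := by
    have hc : Continuous fun M : Matrix (Fin k) (Fin k) ℂ =>
        (star (M *ᵥ v) ⬝ᵥ (Q *ᵥ (M *ᵥ v))).re := by
      refine Complex.continuous_re.comp (Continuous.dotProduct ?_ ?_)
      · exact (Continuous.matrix_mulVec continuous_id continuous_const).star
      · exact Continuous.matrix_mulVec continuous_const
          (Continuous.matrix_mulVec continuous_id continuous_const)
    have := (hc.tendsto 0).comp hA.tendsto_pow
    rw [Matrix.zero_mulVec, star_zero, zero_dotProduct, Complex.zero_re] at this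
    exact this
  have h1 : 0 ≤ (a 1).re := hanti.le_of_tendsto hlim 1
  have h2 : 0 < star v ⬝ᵥ v := Matrix.dotProduct_star_self_pos_iff.2 hv
  have h3 : a 0 = star v ⬝ᵥ v + a 1 := by simpa using ha 0
  have h4 : a 0 = star v ⬝ᵥ (Q *ᵥ v) := by simp [a]
  have h5 : (a 0).im = 0 := by
    rw [h4]
    exact hQ.im_star_dotProduct_mulVec_self v
  rw [← h4, Complex.lt_def]
  refine ⟨?_, h5.symm⟩
  rw [h3, Complex.add_re]
  have := (Complex.lt_def.1 h2).1
  simp only [Complex.zero_re] at this ⊢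
  linarith

namespace FilterBank

variable {n m : ℕ} (S : FilterBank n m)

theorem injective_B : Function.Injective S.B.mulVec := by
  have h := S.B.mulVecLin.finrank_range_add_finrank_ker
  have hr : Module.finrank ℂ (LinearMap.range S.B.mulVecLin) = m := S.fullRank
  rw [hr] at h
  have h0 : Module.finrank ℂ (LinearMap.ker S.B.mulVecLin) = 0 := by simpa using h
  exact LinearMap.ker_eq_bot.1 (Submodule.finrank_eq_zero.1 h0)

theorem exists_left_inv_B : ∃ D : Matrix (Fin m) (Fin n) ℂ, D * S.B = 1 := by
  have h := Matrix.PosDef.conjTranspose_mul_self S.B S.injective_B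
  refine ⟨(S.Bᴴ * S.B)⁻¹ * S.Bᴴ, ?_⟩
  rw [Matrix.mul_assoc, Matrix.nonsing_inv_mul _ ((Matrix.isUnit_iff_isUnit_det _).1 h.isUnit)]

/-- With `Q - A*QA = 1`, take `C` such that `BC` is the `Q`-orthogonal projection onto the range of
`B`. Then `CB = 1`, and `F = (1 - BC)A` satisfies `F*QF ≤ A*QA = Q - 1`, which excludes `v = wFv`
with `v ≠ 0` and `|w| ≤ 1`. -/
theorem nonempty_CPlus : S.CPlus.Nonempty := by
  obtain ⟨Q, hQ, hQe⟩ := exists_conjTranspose_mul_self_lt S.stable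
  have hM : (S.Bᴴ * Q * S.B).PosDef := hQ.conjTranspose_mul_mul_same S.injective_B
  have hMu := (Matrix.isUnit_iff_isUnit_det _).1 hM.isUnit
  obtain ⟨C, hC⟩ : ∃ C, C = (S.Bᴴ * Q * S.B)⁻¹ * (S.Bᴴ * Q) := ⟨_, rfl⟩
  have hCB : C * S.B = 1 := by rw [hC, Matrix.mul_assoc, Matrix.nonsing_inv_mul _ hMu]
  have hpos : IsLowerPos (C * S.B) := by
    rw [hCB]
    exact ⟨fun i j hij => Matrix.one_apply_ne hij.ne, fun i => by simp⟩
  refine ⟨⟨C, hpos.isLowerReal⟩, hpos, ?_⟩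
  change IsSchurStable (S.A - S.B * (C * S.B)⁻¹ * C * S.A)
  have hcl : S.A - S.B * (C * S.B)⁻¹ * C * S.A = (1 - S.B * C) * S.A := by
    rw [hCB, inv_one, Matrix.mul_one, Matrix.sub_mul, Matrix.one_mul]
  have horth : S.Bᴴ * Q * (1 - S.B * C) = 0 := by
    rw [Matrix.mul_sub, Matrix.mul_one, ← Matrix.mul_assoc, hC, ← Matrix.mul_assoc,
      Matrix.mul_nonsing_inv _ hMu, Matrix.one_mul, sub_self]
  -- Pythagoras for the `Q`-orthogonal projection `BC`.
  have hproj : (1 - S.B * C)ᴴ * Q * (1 - S.B * C) = Q - (S.B * C)ᴴ * Q * (S.B * C) := by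
    have h1 : (S.B * C)ᴴ * Q * (1 - S.B * C) = 0 := by
      rw [Matrix.conjTranspose_mul, Matrix.mul_assoc, Matrix.mul_assoc, ← Matrix.mul_assoc S.Bᴴ,
        horth, Matrix.mul_zero]
    have h2 : Q * (S.B * C) = (S.B * C)ᴴ * Q * (S.B * C) := by
      have h3 := congrArg Matrix.conjTranspose h1
      rw [Matrix.conjTranspose_mul, Matrix.conjTranspose_mul, Matrix.conjTranspose_conjTranspose,
        hQ.1.eq, Matrix.conjTranspose_zero, Matrix.conjTranspose_sub, Matrix.sub_mul,
        Matrix.conjTranspose_one, Matrix.one_mul, sub_eq_zero] at h3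
      rw [h3, Matrix.mul_assoc]
    rw [Matrix.conjTranspose_sub, Matrix.sub_mul, Matrix.sub_mul, h1, Matrix.conjTranspose_one,
      Matrix.one_mul, Matrix.mul_sub, Matrix.mul_one, h2, sub_zero]
  rw [hcl, isSchurStable_iff_det_ne_zero]
  intro w hw h0
  obtain ⟨v, hv, hv0⟩ := Matrix.exists_mulVec_eq_zero_iff.2 h0
  rw [Matrix.sub_mulVec, Matrix.one_mulVec, Matrix.smul_mulVec, sub_eq_zero] at hv0
  have hE : ((1 - S.B * C) * S.A)ᴴ * Q * ((1 - S.B * C) * S.A)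
      = Q - 1 - (S.B * C * S.A)ᴴ * Q * (S.B * C * S.A) := by
    calc _ = S.Aᴴ * ((1 - S.B * C)ᴴ * Q * (1 - S.B * C)) * S.A := by
          rw [Matrix.conjTranspose_mul]
          simp only [Matrix.mul_assoc]
      _ = (S.Aᴴ * Q * S.A) - (S.B * C * S.A)ᴴ * Q * (S.B * C * S.A) := by
          rw [hproj, Matrix.mul_sub, Matrix.sub_mul, Matrix.conjTranspose_mul _ S.A]
          simp only [Matrix.mul_assoc]
      _ = _ := by
          rw [← hQe]
          abel
  have hd := (Complex.le_def.1 ((hQ.posSemidef.conjTranspose_mul_mul_same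
    ((1 - S.B * C) * S.A)).dotProduct_mulVec_nonneg v)).1
  have hc := (Complex.le_def.1 ((hQ.posSemidef.conjTranspose_mul_mul_same
    (S.B * C * S.A)).dotProduct_mulVec_nonneg v)).1
  have hb := (Complex.lt_def.1 (Matrix.dotProduct_star_self_pos_iff.2 hv)).1
  have ha : (star v ⬝ᵥ (Q *ᵥ v)).re = ‖w‖ ^ 2 * (star v ⬝ᵥ
      ((((1 - S.B * C) * S.A)ᴴ * Q * ((1 - S.B * C) * S.A)) *ᵥ v)).re := by
    have h1 : star v ⬝ᵥ (Q *ᵥ v) = ((‖w‖ ^ 2 : ℝ) : ℂ) * star v ⬝ᵥ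
        ((((1 - S.B * C) * S.A)ᴴ * Q * ((1 - S.B * C) * S.A)) *ᵥ v) := by
      have hww : star w * w = ((‖w‖ ^ 2 : ℝ) : ℂ) := by
        change (starRingEnd ℂ) w * w = _
        rw [mul_comm, Complex.mul_conj, Complex.normSq_eq_norm_sq]
      nth_rewrite 1 2 [hv0]
      rw [star_smul, smul_dotProduct, Matrix.mulVec_smul, dotProduct_smul, smul_smul, hww,
        smul_eq_mul, Matrix.star_mulVec, ← Matrix.dotProduct_mulVec, Matrix.mulVec_mulVec,
        Matrix.mulVec_mulVec]
    rw [h1, Complex.re_ofReal_mul]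
  have hw2 : ‖w‖ ^ 2 ≤ 1 := pow_le_one₀ (norm_nonneg _) hw
  simp only [Complex.zero_re] at hb hc hd
  have hmul := mul_le_mul_of_nonneg_right hw2 hd
  rw [← ha, one_mul, hE, Matrix.sub_mulVec, Matrix.sub_mulVec, dotProduct_sub, dotProduct_sub,
    Complex.sub_re, Complex.sub_re, Matrix.one_mulVec] at hmul
  linarith

/-! ### The dimension of `𝔠` -/

section Dimension

/-- The lower triangular matrix with real diagonal that has given real coordinates. -/
def lowerRealOfReal (k : ℕ) : Matrix (Fin k) (Fin k) ℝ →ₗ[ℝ] Matrix (Fin k) (Fin k) ℂ where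
  toFun X := Matrix.of fun i j =>
    if j < i then ⟨X i j, X j i⟩ else if i = j then (X i i : ℂ) else 0
  map_add' X Y := by
    ext i j
    rcases lt_trichotomy i j with h | rfl | h
    · simp [h.not_gt, h.ne]
    · simp
    · apply Complex.ext <;> simp [h]
  map_smul' r X := by
    ext i j
    rcases lt_trichotomy i j with h | rfl | h
    · simp [h.not_gt, h.ne]
    · simp
    · apply Complex.ext <;> simp [h]

theorem lowerRealOfReal_apply {k : ℕ} (X : Matrix (Fin k) (Fin k) ℝ) (i j : Fin k) :
    lowerRealOfReal k X i j =
      if j < i then ⟨X i j, X j i⟩ else if i = j then (X i i : ℂ) else 0 := rfl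

theorem lowerRealOfReal_injective (k : ℕ) : Function.Injective (lowerRealOfReal k) := by
  rw [← LinearMap.ker_eq_bot, LinearMap.ker_eq_bot']
  intro X hX
  have h (i j : Fin k) := congrFun (congrFun hX i) j
  simp only [lowerRealOfReal_apply, Matrix.zero_apply] at h
  ext i j
  rcases lt_trichotomy i j with hij | rfl | hij
  · have := congrArg Complex.im (h j i)
    simpa [hij] using this
  · simpa using h i i
  · have := congrArg Complex.re (h i j)
    simpa [hij] using this

theorem mem_range_lowerRealOfReal {k : ℕ} {L : Matrix (Fin k) (Fin k) ℂ} :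
    L ∈ LinearMap.range (lowerRealOfReal k) ↔ IsLowerReal L := by
  constructor
  · rintro ⟨X, rfl⟩
    refine ⟨fun i j hij => ?_, fun i => ?_⟩
    · simp [lowerRealOfReal_apply, hij.not_gt, hij.ne]
    · simp [lowerRealOfReal_apply]
  · intro hL
    refine ⟨Matrix.of fun i j => if i < j then (L j i).im else (L i j).re, ?_⟩
    ext i j
    rw [lowerRealOfReal_apply]
    rcases lt_trichotomy i j with hij | rfl | hij
    · simp [hij.not_gt, hij.ne, hL.1 i j hij]
    · apply Complex.ext <;> simp [hL.2 i]
    · apply Complex.ext <;> simp [hij, hij.not_gt]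

/-- The map `C ↦ CB` is onto, and its kernel, of real dimension `2m(n - m)`, lies in `𝔠`. It sends
`𝔠` onto the triangular matrices with real diagonal, of dimension `m²`. -/
theorem finrank_𝔠 : Module.finrank ℝ S.𝔠 = m * (2 * n - m) := by
  let R : Matrix (Fin m) (Fin n) ℂ →ₗ[ℝ] Matrix (Fin m) (Fin m) ℂ :=
    { toFun := fun C => C * S.B
      map_add' := fun C D => Matrix.add_mul _ _ _
      map_smul' := fun r C => by simp }
  have hsurj (N : Matrix (Fin m) (Fin m) ℂ) : ∃ C : Matrix (Fin m) (Fin n) ℂ, C * S.B = N := by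
    obtain ⟨D, hD⟩ := S.exists_left_inv_B
    exact ⟨N * D, by rw [Matrix.mul_assoc, hD, Matrix.mul_one]⟩
  have hR : LinearMap.range R = ⊤ := LinearMap.range_eq_top.2 hsurj
  have hker : LinearMap.ker R ≤ S.𝔠 := by
    intro C hC
    have hC' : C * S.B = 0 := hC
    exact ⟨by simp [hC'], by simp [hC']⟩
  have h1 := R.finrank_range_add_finrank_ker
  rw [hR, finrank_top, Module.finrank_matrix, Module.finrank_matrix, Complex.finrank_real_complex,
    Fintype.card_fin, Fintype.card_fin] at h1
  have h2 := (R.domRestrict S.𝔠).finrank_range_add_finrank_ker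
  have h3 : LinearMap.range (R.domRestrict S.𝔠) = LinearMap.range (lowerRealOfReal m) := by
    ext N
    rw [mem_range_lowerRealOfReal]
    constructor
    · rintro ⟨C, rfl⟩
      exact C.2
    · intro hN
      obtain ⟨C, rfl⟩ := hsurj N
      exact ⟨⟨C, hN⟩, rfl⟩
  have h4 : Module.finrank ℝ (LinearMap.range (lowerRealOfReal m)) = m * m := by
    rw [LinearMap.finrank_range_of_inj (lowerRealOfReal_injective m), Module.finrank_matrix]
    simp
  have h5 : Module.finrank ℝ (LinearMap.ker (R.domRestrict S.𝔠))
      = Module.finrank ℝ (LinearMap.ker R) := by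
    rw [LinearMap.ker_domRestrict]
    exact (Submodule.comapSubtypeEquivOfLe hker).finrank_eq
  rw [h3, h4, h5] at h2
  have hmn : m ≤ n := by
    have := S.B.rank_le_card_height
    rw [S.fullRank] at this
    simpa using this
  obtain ⟨d, rfl⟩ := Nat.exists_eq_add_of_le hmn
  have h6 : 2 * (m + d) - m = m + 2 * d := by omega
  rw [h6]
  linarith

end Dimension

end FilterBank

/-! ### Calculus of the quadratic map `C ↦ Π(C*C)` -/

theorem contDiff_diag_of_bilinear {E F : Type*} [NormedAddCommGroup E] [NormedSpace ℝ E]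
    [NormedAddCommGroup F] [NormedSpace ℝ F] {b : E × E → F} (hb : IsBoundedBilinearMap ℝ b) :
    ContDiff ℝ 1 fun x : E => b (x, x) :=
  hb.contDiff.comp (f := fun x : E => (x, x)) (contDiff_id.prodMk contDiff_id)

theorem hasStrictFDerivAt_diag_of_bilinear {E F : Type*} [NormedAddCommGroup E] [NormedSpace ℝ E]
    [NormedAddCommGroup F] [NormedSpace ℝ F] {b : E × E → F} (hb : IsBoundedBilinearMap ℝ b)
    {f' : E →L[ℝ] F} {x : E} (hf' : ∀ v, f' v = b (x, v) + b (v, x)) :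
    HasStrictFDerivAt (fun x : E => b (x, x)) f' x := by
  have h1 : HasStrictFDerivAt (fun x : E => (x, x))
      ((ContinuousLinearMap.id ℝ E).prod (ContinuousLinearMap.id ℝ E)) x :=
    (hasStrictFDerivAt_id x).prodMk (hasStrictFDerivAt_id x)
  refine (HasStrictFDerivAt.comp x (f := fun x : E => (x, x)) (hb.hasStrictFDerivAt (x, x))
    h1).congr_fderiv ?_
  ext1 v
  simp [hf']

namespace FilterBank

variable {n m : ℕ} (S : FilterBank n m)

section Calculus

/-- The bilinear map `(C, V) ↦ Π_{im Γ} (C* V)`. -/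
def projBilin : S.𝔠 →ₗ[ℝ] S.𝔠 →ₗ[ℝ] S.imΓ :=
  LinearMap.mk₂ ℝ (fun C V => S.imΓ.orthogonalProjectionOnto
      ((C : Matrix (Fin m) (Fin n) ℂ)ᴴ * (V : Matrix (Fin m) (Fin n) ℂ)))
    (fun C C' V => by simp [Matrix.add_mul])
    (fun r C V => by simp)
    (fun C V V' => by simp [Matrix.mul_add])
    (fun r C V => by simp)

theorem isBoundedBilinearMap_projBilin :
    IsBoundedBilinearMap ℝ fun p : S.𝔠 × S.𝔠 => S.projBilin p.1 p.2 :=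
  { add_left := fun C C' V => S.projBilin.map_add₂ C C' V
    smul_left := fun r C V => S.projBilin.map_smul₂ r C V
    add_right := fun C V V' => (S.projBilin C).map_add V V'
    smul_right := fun r C V => (S.projBilin C).map_smul r V
    bound := by
      refine ⟨1, one_pos, fun C V => ?_⟩
      rw [one_mul]
      refine (S.imΓ.norm_orthogonalProjectionOnto_apply_le _).trans
        ((Matrix.frobenius_norm_mul _ _).trans_eq ?_)
      rw [Matrix.frobenius_norm_conjTranspose]
      rfl }

theorem contDiff_hInv : ContDiff ℝ 1 S.hInv :=
  contDiff_diag_of_bilinear S.isBoundedBilinearMap_projBilin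

/-- The derivative `V ↦ Π_{im Γ} (C* V + V* C)` of `hInv` at `C`. -/
def hInvDeriv (C : S.𝔠) : S.𝔠 →ₗ[ℝ] S.imΓ := S.projBilin C + S.projBilin.flip C

theorem hInvDeriv_apply (C V : S.𝔠) : S.hInvDeriv C V = S.imΓ.orthogonalProjectionOnto
    ((C : Matrix (Fin m) (Fin n) ℂ)ᴴ * (V : Matrix (Fin m) (Fin n) ℂ)
      + (V : Matrix (Fin m) (Fin n) ℂ)ᴴ * (C : Matrix (Fin m) (Fin n) ℂ)) := by
  rw [map_add]
  rfl

theorem bijective_hInvDeriv {C : S.𝔠} (hC : C ∈ S.CPlus) :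
    Function.Bijective (S.hInvDeriv C) := by
  constructor
  · rw [← LinearMap.ker_eq_bot, LinearMap.ker_eq_bot']
    intro V hV
    rw [hInvDeriv_apply, Submodule.orthogonalProjectionOnto_eq_zero_iff] at hV
    exact Subtype.ext (S.eq_zero_of_symmetrized_mem_orthogonal hC.1 hC.2 V.2 hV)
  · intro Λ
    obtain ⟨V, hV, h⟩ := S.exists_symmetrized_sub_mem_orthogonal hC.1 hC.2
      (S.isHermitian_of_mem_imΓ Λ.2)
    refine ⟨⟨V, hV⟩, ?_⟩
    rw [← Submodule.orthogonalProjectionOnto_eq_zero_iff, map_sub,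
      Submodule.orthogonalProjectionOnto_mem_subspace_eq_self, sub_eq_zero] at h
    rw [hInvDeriv_apply, h]

/-- The derivative of `hInv` at a point of `𝓒₊`, as an isomorphism. -/
def hInvDerivEquiv {C : S.𝔠} (hC : C ∈ S.CPlus) : S.𝔠 ≃ₗ[ℝ] S.imΓ :=
  LinearEquiv.ofBijective (S.hInvDeriv C) (S.bijective_hInvDeriv hC)

theorem hasStrictFDerivAt_hInv {C : S.𝔠} (hC : C ∈ S.CPlus) :
    HasStrictFDerivAt S.hInv
      ((S.hInvDerivEquiv hC).toContinuousLinearEquiv : S.𝔠 →L[ℝ] S.imΓ) C :=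
  hasStrictFDerivAt_diag_of_bilinear S.isBoundedBilinearMap_projBilin fun _ => rfl

theorem finrank_imΓ : Module.finrank ℝ S.imΓ = m * (2 * n - m) := by
  obtain ⟨C, hC⟩ := S.nonempty_CPlus
  rw [← (S.hInvDerivEquiv hC).finrank_eq, S.finrank_𝔠]

theorem det_fderiv_hInv_ne_zero (b : Module.Basis (Fin (m * (2 * n - m))) ℝ S.𝔠)
    (b' : Module.Basis (Fin (m * (2 * n - m))) ℝ S.imΓ) {C : S.𝔠} (hC : C ∈ S.CPlus) :
    (LinearMap.toMatrix b b' (fderiv ℝ S.hInv C).toLinearMap).det ≠ 0 := by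
  rw [(S.hasStrictFDerivAt_hInv hC).hasFDerivAt.fderiv]
  exact ((S.hInvDerivEquiv hC).isUnit_det b b').ne_zero

end Calculus

/-! ### Openness of `𝓒₊` and convexity of `𝓛₊ ∩ im Γ` -/

section Topology

/-- The tube lemma: projection along a compact factor is closed. -/
theorem isOpen_forall_of_compactSpace {X Y : Type*} [TopologicalSpace X] [TopologicalSpace Y]
    [CompactSpace Y] {p : X → Y → Prop} (h : IsOpen {q : X × Y | p q.1 q.2}) :
    IsOpen {x | ∀ y, p x y} := by
  rw [← isClosed_compl_iff]
  convert isClosedMap_fst_of_compactSpace _ h.isClosed_compl using 1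
  ext x
  simp

theorem continuous_K : Continuous fun w : Metric.closedBall (0 : ℂ) 1 => S.K w := by
  refine continuous_matrix fun i j => ?_
  have h : ContinuousOn (fun w => S.K w i j) (Metric.closedBall (0 : ℂ) 1) := fun w hw => by
    have := (S.differentiableAt_K 1 (mem_closedBall_zero_iff.1 hw) i j).continuousAt
    simp only [Matrix.one_mul] at this
    exact this.continuousWithinAt
  exact h.domRestrict

theorem isOpen_CPlus : IsOpen S.CPlus := by
  have h : S.CPlus = (⋂ i, {C : S.𝔠 | 0 < (((C : Matrix (Fin m) (Fin n) ℂ) * S.B) i i).re}) ∩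
      {C : S.𝔠 | ∀ w : Metric.closedBall (0 : ℂ) 1,
        ((C : Matrix (Fin m) (Fin n) ℂ) * S.K w).det ≠ 0} := by
    ext C
    simp only [Set.mem_inter_iff, Set.mem_iInter, Set.mem_ofPred_eq, Subtype.forall,
      mem_closedBall_zero_iff]
    exact ⟨fun h => ⟨fun i => (h.1.2 i).2, (S.mem_CPlus_iff.1 h).2⟩,
      fun h => S.mem_CPlus_iff.2 ⟨fun i => (h.1 i).le, h.2⟩⟩
  rw [h]
  refine IsOpen.inter (isOpen_iInter_of_finite fun i => ?_) (isOpen_forall_of_compactSpace ?_)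
  · refine isOpen_lt continuous_const (Complex.continuous_re.comp ?_)
    exact (continuous_subtype_val.matrix_mul continuous_const).matrix_elem i i
  · refine isOpen_ne_fun (Continuous.matrix_det ?_) continuous_const
    exact (continuous_subtype_val.comp continuous_fst).matrix_mul
      (S.continuous_K.comp continuous_snd)

theorem mem_LPlusΓ_iff {Λ : S.imΓ} : Λ ∈ S.LPlusΓ ↔ ∀ (z : Circle) (v : Fin m → ℂ), v ≠ 0 →
    0 < (star v ⬝ᵥ (((S.G z)ᴴ * (Λ : Matrix (Fin n) (Fin n) ℂ) * S.G z) *ᵥ v)).re := by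
  have hΛ := S.isHermitian_of_mem_imΓ Λ.2
  constructor
  · intro h z v hv
    exact (Complex.lt_def.1 ((h.2 z).dotProduct_mulVec_pos hv)).1
  · intro h
    refine ⟨hΛ, fun z => ?_⟩
    have hz := Matrix.isHermitian_conjTranspose_mul_mul (S.G z) hΛ
    refine Matrix.PosDef.of_dotProduct_mulVec_pos hz fun v hv => ?_
    exact Complex.lt_def.2 ⟨h z v hv, (hz.im_star_dotProduct_mulVec_self v).symm⟩

theorem continuous_G_congr {X : Type*} [TopologicalSpace X] {f : X → S.imΓ} {g : X → Circle}
    (hf : Continuous f) (hg : Continuous g) : Continuous fun x : X =>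
      (S.G (g x))ᴴ * (f x : Matrix (Fin n) (Fin n) ℂ) * S.G (g x) := by
  have h : Continuous fun x : X => S.G (g x) := S.continuous_G.comp hg
  exact (h.matrix_conjTranspose.matrix_mul (continuous_subtype_val.comp hf)).matrix_mul h

theorem convex_LPlusΓ : Convex ℝ S.LPlusΓ := by
  intro Λ hΛ Λ' hΛ' a b ha hb hab
  rw [mem_LPlusΓ_iff] at *
  intro z v hv
  have h1 : star v ⬝ᵥ (((S.G z)ᴴ * ((a • Λ + b • Λ' : S.imΓ) : Matrix (Fin n) (Fin n) ℂ) *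
      S.G z) *ᵥ v) =
      a • (star v ⬝ᵥ (((S.G z)ᴴ * (Λ : Matrix (Fin n) (Fin n) ℂ) * S.G z) *ᵥ v)) +
      b • (star v ⬝ᵥ (((S.G z)ᴴ * (Λ' : Matrix (Fin n) (Fin n) ℂ) * S.G z) *ᵥ v)) := by
    rw [Submodule.coe_add, Submodule.coe_smul, Submodule.coe_smul, Matrix.mul_add, Matrix.add_mul,
      Matrix.mul_smul, Matrix.mul_smul, Matrix.smul_mul, Matrix.smul_mul, Matrix.add_mulVec,
      Matrix.smul_mulVec, Matrix.smul_mulVec, dotProduct_add, dotProduct_smul, dotProduct_smul]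
  rw [h1, Complex.add_re, Complex.smul_re, Complex.smul_re, smul_eq_mul, smul_eq_mul]
  have h2 := hΛ z v hv
  have h3 := hΛ' z v hv
  rcases ha.eq_or_lt with rfl | ha
  · have : b = 1 := by linarith
    subst this
    linarith
  · have := mul_pos ha h2
    have := mul_nonneg hb h3.le
    linarith

end Topology

end FilterBank

/-- A jointly injective continuous family of linear maps, parametrized by a compact space, is
jointly bounded below. -/
theorem exists_norm_le_of_jointly_injective {X E F : Type*} [TopologicalSpace X] [CompactSpace X]
    [NormedAddCommGroup E] [NormedSpace ℝ E] [FiniteDimensional ℝ E] [NormedAddCommGroup F]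
    [NormedSpace ℝ F] (f : X → E →ₗ[ℝ] F) (hf : ∀ e, Continuous fun x => f x e)
    (hinj : ∀ e, (∀ x, f x e = 0) → e = 0) :
    ∃ c : ℝ, 0 ≤ c ∧ ∀ (e : E) (r : ℝ), 0 ≤ r → (∀ x, ‖f x e‖ ≤ r) → ‖e‖ ≤ c * r := by
  -- Joint injectivity is injectivity into `C(X, F)` with the sup norm, and an injective linear map
  -- on a finite-dimensional space is bounded below.
  let T : E →ₗ[ℝ] C(X, F) :=
    { toFun := fun e => ⟨fun x => f x e, hf e⟩
      map_add' := fun e e' => ContinuousMap.ext fun x => (f x).map_add e e'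
      map_smul' := fun r e => ContinuousMap.ext fun x => (f x).map_smul r e }
  have hker : LinearMap.ker T = ⊥ := by
    rw [LinearMap.ker_eq_bot']
    exact fun e he => hinj e fun x => DFunLike.congr_fun he x
  obtain ⟨c, -, hc⟩ := T.exists_antilipschitzWith hker
  refine ⟨c, c.2, fun e r hr h => (ZeroHomClass.bound_of_antilipschitz T hc e).trans ?_⟩
  exact mul_le_mul_of_nonneg_left ((ContinuousMap.norm_le _ hr).2 h) c.2

namespace FilterBank

variable {n m : ℕ} (S : FilterBank n m)

/-! ### Closedness of the image and surjectivity -/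

section Properness

theorem norm_inv_coe (z : Circle) : ‖((z : ℂ)⁻¹)‖ = 1 := by simp [Circle.norm_coe]

/-- The values of `C G` on the circle control `C`. -/
theorem exists_norm_le_of_mul_G : ∃ c : ℝ, 0 ≤ c ∧ ∀ (C : S.𝔠) (r : ℝ), 0 ≤ r →
    (∀ z : Circle, ‖(C : Matrix (Fin m) (Fin n) ℂ) * S.G z‖ ≤ r) → ‖C‖ ≤ c * r := by
  refine exists_norm_le_of_jointly_injective (fun z : Circle =>
    { toFun := fun C : S.𝔠 => (C : Matrix (Fin m) (Fin n) ℂ) * S.G z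
      map_add' := fun C D => Matrix.add_mul _ _ _
      map_smul' := fun r C => Matrix.smul_mul _ _ _ }) (fun C => ?_) fun C hC => ?_
  · exact (continuous_const (y := (C : Matrix (Fin m) (Fin n) ℂ))).matrix_mul S.continuous_G
  · refine Subtype.ext (S.eq_zero_of_mul_K fun w hw => ?_)
    obtain ⟨z, rfl⟩ := exists_circle_inv_eq hw
    have h1 : (C : Matrix (Fin m) (Fin n) ℂ) * S.G z = 0 := hC z
    rw [G_eq, Matrix.mul_smul] at h1
    exact (smul_eq_zero.1 h1).resolve_left (inv_ne_zero (Circle.coe_ne_zero z))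

theorem norm_mul_G_sq (C : S.𝔠) (z : Circle) :
    ‖(C : Matrix (Fin m) (Fin n) ℂ) * S.G z‖ ^ 2 =
      ((S.G z)ᴴ * (S.hInv C : Matrix (Fin n) (Fin n) ℂ) * S.G z).trace.re := by
  rw [hInv_spec, ← Matrix.conjTranspose_mul, Matrix.mul_assoc]
  exact (real_inner_self_eq_norm_sq ((C : Matrix (Fin m) (Fin n) ℂ) * S.G z)).symm

theorem norm_det_mul_K_sq (C : S.𝔠) (z : Circle) :
    ‖((C : Matrix (Fin m) (Fin n) ℂ) * S.K (z : ℂ)⁻¹).det‖ ^ 2 =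
      ((S.G z)ᴴ * (S.hInv C : Matrix (Fin n) (Fin n) ℂ) * S.G z).det.re := by
  rw [hInv_spec, ← Matrix.conjTranspose_mul, Matrix.mul_assoc, Matrix.det_mul,
    Matrix.det_conjTranspose]
  change _ = ((starRingEnd ℂ) _ * _).re
  rw [mul_comm, Complex.mul_conj, Complex.ofReal_re, Complex.normSq_eq_norm_sq, G_eq,
    Matrix.mul_smul, Matrix.det_smul, norm_mul, norm_pow, norm_inv_coe, one_pow, one_mul]

/-- A lower bound for `det C G` on the circle extends to the disc when `C ∈ 𝓒₊`. -/
theorem le_norm_det_mul_K {C : S.𝔠} (hC : C ∈ S.CPlus) {d : ℝ} (hd : 0 < d)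
    (h : ∀ z : Circle,
      d ^ 2 ≤ ((S.G z)ᴴ * (S.hInv C : Matrix (Fin n) (Fin n) ℂ) * S.G z).det.re)
    {w : ℂ} (hw : ‖w‖ ≤ 1) : d ≤ ‖((C : Matrix (Fin m) (Fin n) ℂ) * S.K w).det‖ := by
  have h0 := (S.mem_CPlus_iff.1 hC).2
  -- Since `det CK` has no zeros in the closed disc, the maximum principle applies to its
  -- reciprocal.
  have h1 := norm_le_of_norm_le_on_circle
    (f := fun w => (((C : Matrix (Fin m) (Fin n) ℂ) * S.K w).det)⁻¹) (c := d⁻¹)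
    (fun w hw => (differentiableAt_det (S.differentiableAt_K _ hw)).inv (h0 w hw))
    (fun w hw => by
      obtain ⟨z, rfl⟩ := exists_circle_inv_eq hw
      rw [norm_inv]
      refine inv_anti₀ hd ?_
      have h2 := h z
      rw [← norm_det_mul_K_sq] at h2
      exact le_of_sq_le_sq h2 (norm_nonneg _)) hw
  rw [norm_inv] at h1
  exact (inv_le_inv₀ (norm_pos_iff.2 (h0 w hw)) hd).1 h1

/-- Along a sequence with `hInv (C k) → Λ`, the trace of `G*ΛG` bounds `CG` on the circle and hence
`C`, so a subsequence converges. The determinant of `G*ΛG` bounds `|det CK|` away from zero on the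
whole disc, which keeps the limit in `𝓒₊`. -/
theorem mem_image_of_mem_closure {Λ : S.imΓ} (hΛ : Λ ∈ S.LPlusΓ)
    (hcl : Λ ∈ closure (S.hInv '' S.CPlus)) : Λ ∈ S.hInv '' S.CPlus := by
  obtain ⟨y, hy, hyΛ⟩ := mem_closure_iff_seq_limit.1 hcl
  choose C hC hCy using hy
  obtain rfl : (fun k => S.hInv (C k)) = y := funext hCy
  have hcont : Continuous S.hInv := S.contDiff_hInv.continuous
  have htr : Continuous fun q : S.imΓ × Circle =>
      ((S.G q.2)ᴴ * (q.1 : Matrix (Fin n) (Fin n) ℂ) * S.G q.2).trace.re :=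
    Complex.continuous_re.comp (S.continuous_G_congr continuous_fst continuous_snd).matrix_trace
  have hdet : Continuous fun q : S.imΓ × Circle =>
      ((S.G q.2)ᴴ * (q.1 : Matrix (Fin n) (Fin n) ℂ) * S.G q.2).det.re :=
    Complex.continuous_re.comp (S.continuous_G_congr continuous_fst continuous_snd).matrix_det
  have hsec : Continuous fun z : Circle => (Λ, z) := continuous_const.prodMk continuous_id
  -- The bounds `r` and `d` are strict for `Λ`; by compactness of the circle they therefore hold for
  -- all nearby `hInv (C k)`.
  obtain ⟨r, hr⟩ : ∃ r : ℝ, ∀ z : Circle,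
      ((S.G z)ᴴ * (Λ : Matrix (Fin n) (Fin n) ℂ) * S.G z).trace.re < r := by
    obtain ⟨z, -, hz⟩ := isCompact_univ.exists_isMaxOn Set.univ_nonempty
      (htr.comp hsec).continuousOn
    exact ⟨_, fun z' => (hz (Set.mem_univ z')).trans_lt (lt_add_one _)⟩
  obtain ⟨d, hd0, hd⟩ : ∃ d : ℝ, 0 < d ∧ ∀ z : Circle,
      d ^ 2 < ((S.G z)ᴴ * (Λ : Matrix (Fin n) (Fin n) ℂ) * S.G z).det.re := by
    obtain ⟨z, -, hz⟩ := isCompact_univ.exists_isMinOn Set.univ_nonempty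
      (hdet.comp hsec).continuousOn
    have hpos := (Complex.lt_def.1 (hΛ.2 z).det_pos).1
    rw [Complex.zero_re] at hpos
    obtain ⟨d, hd0, hd⟩ := exists_between (Real.sqrt_pos.2 hpos)
    exact ⟨d, hd0, fun z' => ((Real.lt_sqrt hd0.le).1 hd).trans_le (hz (Set.mem_univ z'))⟩
  have ev1 : ∀ᶠ k in atTop, ∀ z : Circle,
      ((S.G z)ᴴ * (S.hInv (C k) : Matrix (Fin n) (Fin n) ℂ) * S.G z).trace.re < r :=
    hyΛ.eventually ((isOpen_forall_of_compactSpace (p := fun (Λ : S.imΓ) (z : Circle) =>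
      ((S.G z)ᴴ * (Λ : Matrix (Fin n) (Fin n) ℂ) * S.G z).trace.re < r)
      (isOpen_lt htr continuous_const)).mem_nhds hr)
  have ev2 : ∀ᶠ k in atTop, ∀ z : Circle,
      d ^ 2 < ((S.G z)ᴴ * (S.hInv (C k) : Matrix (Fin n) (Fin n) ℂ) * S.G z).det.re :=
    hyΛ.eventually ((isOpen_forall_of_compactSpace (p := fun (Λ : S.imΓ) (z : Circle) =>
      d ^ 2 < ((S.G z)ᴴ * (Λ : Matrix (Fin n) (Fin n) ℂ) * S.G z).det.re)
      (isOpen_lt continuous_const hdet)).mem_nhds hd)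
  obtain ⟨c, hc0, hc⟩ := S.exists_norm_le_of_mul_G
  have hfreq : ∃ᶠ k in atTop, C k ∈ Metric.closedBall (0 : S.𝔠) (c * Real.sqrt r) := by
    refine (ev1.mono fun k hk => ?_).frequently
    rw [mem_closedBall_zero_iff]
    refine hc _ _ (Real.sqrt_nonneg _) fun z => Real.le_sqrt_of_sq_le ?_
    rw [norm_mul_G_sq]
    exact (hk z).le
  have hprop : ProperSpace S.𝔠 := FiniteDimensional.proper ℝ S.𝔠
  obtain ⟨C₀, -, φ, hφ, hlim⟩ := tendsto_subseq_of_frequently_bounded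
    Metric.isBounded_closedBall hfreq
  have hval : Tendsto (fun k => (C (φ k) : Matrix (Fin m) (Fin n) ℂ)) atTop (𝓝 C₀) :=
    (continuous_subtype_val.tendsto C₀).comp hlim
  refine ⟨C₀, S.mem_CPlus_iff.2 ⟨fun i => ?_, fun w hw => ?_⟩, ?_⟩
  · have hci : Continuous fun M : Matrix (Fin m) (Fin n) ℂ => ((M * S.B) i i).re :=
      Complex.continuous_re.comp ((continuous_id.matrix_mul continuous_const).matrix_elem i i)
    exact ge_of_tendsto' ((hci.tendsto _).comp hval)
      fun k => (S.mem_CPlus_iff.1 (hC (φ k))).1 i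
  · have hci : Continuous fun M : Matrix (Fin m) (Fin n) ℂ => ‖(M * S.K w).det‖ :=
      (continuous_id.matrix_mul continuous_const).matrix_det.norm
    have h1 : d ≤ ‖((C₀ : Matrix (Fin m) (Fin n) ℂ) * S.K w).det‖ :=
      ge_of_tendsto ((hci.tendsto _).comp hval) ((hφ.tendsto_atTop.eventually ev2).mono
        fun k hk => S.le_norm_det_mul_K (hC (φ k)) hd0 (fun z => (hk z).le) hw)
    exact norm_pos_iff.1 (hd0.trans_le h1)
  · exact tendsto_nhds_unique ((hcont.tendsto C₀).comp hlim) (hyΛ.comp hφ.tendsto_atTop)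

theorem isOpenMap_hInv_restrict : IsOpenMap (S.CPlus.domRestrict S.hInv) := by
  rw [isOpenMap_iff_nhds_le]
  intro C
  have h1 := (S.hasStrictFDerivAt_hInv C.2).map_nhds_eq_of_equiv
  have h2 : map (Subtype.val : S.CPlus → S.𝔠) (𝓝 C) = 𝓝 (C : S.𝔠) :=
    S.isOpen_CPlus.isOpenEmbedding_subtypeVal.map_nhds_eq C
  rw [← h2, map_map] at h1
  exact h1.ge

/-- The image is nonempty, open and relatively closed in a connected set. -/
theorem image_hInv : S.hInv '' S.CPlus = S.LPlusΓ := by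
  refine Set.Subset.antisymm (Set.image_subset_iff.2 fun C hC => S.hInv_mem_LPlusΓ hC) ?_
  have hopen : IsOpen (S.hInv '' S.CPlus) := by
    rw [← Set.range_domRestrict]
    exact S.isOpenMap_hInv_restrict.isOpen_range
  obtain ⟨C, hC⟩ := S.nonempty_CPlus
  exact S.convex_LPlusΓ.isPreconnected.subset_of_closure_inter_subset hopen
    ⟨S.hInv C, S.hInv_mem_LPlusΓ hC, C, hC, rfl⟩
    fun Λ hΛ => S.mem_image_of_mem_closure hΛ.2 hΛ.1

end Properness

section Factorization

/-- The map `hInv` as a homeomorphism of `𝓒₊` onto `𝓛₊ ∩ im Γ`. -/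
def hInvHomeomorph : OpenPartialHomeomorph S.𝔠 S.imΓ :=
  OpenPartialHomeomorph.ofContinuousOpenRestrict (S.injOn_hInv.toPartialEquiv S.hInv S.CPlus)
    S.contDiff_hInv.continuous.continuousOn S.isOpenMap_hInv_restrict S.isOpen_CPlus

theorem hInvHomeomorph_source : S.hInvHomeomorph.source = S.CPlus := rfl

theorem hInvHomeomorph_target : S.hInvHomeomorph.target = S.LPlusΓ := S.image_hInv

theorem isSpectralFactor_hInvHomeomorph_symm {Λ : S.imΓ} (hΛ : Λ ∈ S.LPlusΓ) :
    S.IsSpectralFactor Λ (S.hInvHomeomorph.symm Λ : Matrix (Fin m) (Fin n) ℂ) := by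
  rw [← hInvHomeomorph_target] at hΛ
  exact S.isSpectralFactor_iff.2 ⟨(S.hInvHomeomorph.symm Λ).2,
    S.hInvHomeomorph.map_target hΛ, S.hInvHomeomorph.right_inv hΛ⟩

theorem contDiffOn_hInvHomeomorph_symm :
    ContDiffOn ℝ 1 S.hInvHomeomorph.symm S.LPlusΓ := by
  intro Λ hΛ
  rw [← hInvHomeomorph_target] at hΛ
  exact (S.hInvHomeomorph.contDiffAt_symm hΛ
    (S.hasStrictFDerivAt_hInv (S.hInvHomeomorph.map_target hΛ)).hasFDerivAt
    S.contDiff_hInv.contDiffAt).contDiffWithinAt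

end Factorization

end FilterBank

end SpectralFactorization

end

theorem mainTheorem1 {n m : ℕ} (S : SpectralFactorization.FilterBank n m) :
    -- `𝔠` and `im Γ` have the same real dimension, so that the Jacobian determinant makes sense
    Module.finrank ℝ S.𝔠 = m * (2 * n - m) ∧ Module.finrank ℝ S.imΓ = m * (2 * n - m) ∧
    -- `h⁻¹` maps `𝓒₊` into `𝓛₊ ∩ im Γ`, and its Jacobian determinant never vanishes on `𝓒₊`
    (∀ C ∈ S.CPlus, S.hInv C ∈ S.LPlusΓ) ∧
    (∀ (b : Module.Basis (Fin (m * (2 * n - m))) ℝ S.𝔠)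
      (b' : Module.Basis (Fin (m * (2 * n - m))) ℝ S.imΓ), ∀ C ∈ S.CPlus,
        (LinearMap.toMatrix b b' (fderiv ℝ S.hInv C).toLinearMap).det ≠ 0) ∧
    -- for `Λ ∈ 𝓛₊ ∩ im Γ` the stabilizing solution and the factor `C` exist and are unique
    (∀ Λ ∈ S.LPlusΓ, (∃! P : Matrix (Fin n) (Fin n) ℂ, S.IsStabilizingSolution Λ P) ∧
      ∃! C : Matrix (Fin m) (Fin n) ℂ, S.IsSpectralFactor Λ C) ∧
    -- the map `h : Λ ↦ C` is a `C¹` diffeomorphism of the open set `𝓛₊ ∩ im Γ` onto the open set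
    -- `𝓒₊`, with inverse `hInv`, and it satisfies `G* Λ G = G* C* C G` on the unit circle
    ∃ h : OpenPartialHomeomorph S.imΓ S.𝔠,
      h.source = S.LPlusΓ ∧ h.target = S.CPlus ∧
      (∀ Λ ∈ S.LPlusΓ, S.IsSpectralFactor Λ (h Λ : Matrix (Fin m) (Fin n) ℂ)) ∧
      (∀ C ∈ S.CPlus, h.symm C = S.hInv C) ∧
      ContDiffOn ℝ 1 h S.LPlusΓ ∧ ContDiffOn ℝ 1 h.symm S.CPlus ∧
      ∀ Λ ∈ S.LPlusΓ, ∀ z : Circle,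
        (S.G z)ᴴ * (Λ : Matrix (Fin n) (Fin n) ℂ) * S.G z =
          (S.G z)ᴴ * (h Λ : Matrix (Fin m) (Fin n) ℂ)ᴴ * (h Λ : Matrix (Fin m) (Fin n) ℂ) *
            S.G z := by
  refine ⟨S.finrank_𝔠, S.finrank_imΓ, fun C hC => S.hInv_mem_LPlusΓ hC,
    fun b b' C hC => S.det_fderiv_hInv_ne_zero b b' hC, fun Λ hΛ => ?_,
    S.hInvHomeomorph.symm, S.hInvHomeomorph_target, S.hInvHomeomorph_source,
    fun Λ hΛ => S.isSpectralFactor_hInvHomeomorph_symm hΛ, fun C _ => rfl,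
    S.contDiffOn_hInvHomeomorph_symm, S.contDiff_hInv.contDiffOn, fun Λ hΛ z => ?_⟩
  · have h := S.isSpectralFactor_hInvHomeomorph_symm hΛ
    obtain ⟨P, L, hP, hL⟩ := id h
    exact ⟨⟨P, hP, fun P' hP' =>
        SpectralFactorization.FilterBank.IsStabilizingSolution.unique S hP' hP⟩,
      ⟨_, h, fun C' hC' => SpectralFactorization.FilterBank.IsSpectralFactor.unique S hC' h⟩⟩
  · rw [← S.hInvHomeomorph_target] at hΛ
    exact S.hInv_eq_iff.1 (S.hInvHomeomorph.right_inv hΛ) z
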